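/- **Setting.** Let $x\cdot y=x^0y^0-x^1y^1-x^2y^2-x^3y^3$ be the Minkowski product on $\mathbb R^4$, write $x^2=x\cdot x$, and let $\mathbb V=\{(\sqrt{m^2+|\vec p|^2},\vec p): \vec p\in\mathbb R^3,\ m\ge 0\}$. Consider five-tuples $e=(p,q,a,b,c)$ of four-vectors. The group $G=SO^+(1,3)\times S_2\times S_3$ acts on them: a proper orthochronous Lorentz transformation acts on all five vectors simultaneously, $S_2$ permutes $p,q$, and $S_3$ permutes $a,b,c$. Parity $\mathscr P$ sends each vector $(E,\vec p)$ to $(E,-\vec p)$. A *collision event* $(pq)\to(abc)+X$ is a tuple $e\in\mathbb V^5$ with $p^2q^2<(p\cdot q)^2$; it is *chiral* if $\mathscr P e\notin G e$. **Ingredients.** Fix the sign convention $\epsilon_{0123}\in\{+1,-1\}$ and non-zero real constants $u_1,\dots,u_{15}$. Put $$\epsilon^{yz}=\epsilon_{\mu\nu\sigma\tau}y^\mu z^\nu p^\sigma q^\tau,\qquad g^y_z=(y\cdot z)(p+q)^2-\big(y\cdot(p+q)\big)\big(z\cdot(p+q)\big),$$ $$P_1=\epsilon^{ab}+\epsilon^{bc}+\epsilon^{ca},\quad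 P_2=\epsilon^{ab}\epsilon^{bc}\epsilon^{ca},\quad P_3=(\epsilon^{ab}-\epsilon^{bc})(\epsilon^{bc}-\epsilon^{ca})(\epsilon^{ca}-\epsilon^{ab}),$$ $$F_0=p^2-q^2,\quad F_1=g^{a+b+c}_{p-q},\quad F_2=g^a_{p-q}g^b_{p-q}g^c_{p-q},\quad F_3=g^{a-b}_{p-q}g^{b-c}_{p-q}g^{c-a}_{p-q},$$ $$P_{\mathbb C}(u)=P_1^3+iuP_2,\qquad F_{\mathbb C}(u)=F_1+iuF_2,$$ $$\delta_1^{yz}=g^y_y-g^z_z,\quad \delta_2^{yz}=g^{y-z}_{a+b+c},\quad \delta_3^{yz}=y^2-z^2,\quad \delta_4^{yz}=g^{y-z}_{p-q},\quad D_u^{yz}=\delta_1^{yz}+iu\,\delta_2^{yz},$$ $$U[f,h]=f^{ab}f^{bc}h^{ca}+f^{ab}h^{bc}f^{ca}+h^{ab}f^{bc}f^{ca}.$$ **Variables.** Define $$V_1=P_1F_3,\quad V_2=P_2F_3,\quad V_3=P_3F_0,\quad V_4=P_3F_1,\quad V_5=P_3F_2,$$ $$V_6=\sum_{\text{perms of }a,b,c}P_3F_3\,g^a_{p-q}g^c_{p-q}\big((\epsilon^{ab})^2-(\epsilon^{cb})^2\big),\qquad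 V_7=\sum_{\text{perms of }a,b,c}P_3F_3\,g^a_{p-q}g^c_{p-q}\,(a^2-c^2),$$ (in each sum $a,b,c$ are permuted in every factor of the summand) and $V_{6+2k}=\operatorname{Re}v_k$, $V_{7+2k}=\operatorname{Im}v_k$ for $k=1,\dots,6$, where $$\begin{aligned} v_1&=P_{\mathbb C}(u_2)\,U[D_{u_1},\,D_{u_1}F_{\mathbb C}(u_3)], & v_2&=P_{\mathbb C}(u_5)\,U[D_{u_4},\,D_{u_4}F_0],\\ v_3&=P_{\mathbb C}(u_8)\,U[D_{u_6},\,\delta_3F_{\mathbb C}(u_7)], & v_4&=P_{\mathbb C}(u_{11})\,U[D_{u_9},\,\delta_3F_0+iu_{10}\delta_4],\\ v_5&=P_{\mathbb C}(u_{12})\,U[\delta_3,\,\delta_3F_{\mathbb C}(u_{13})], & v_6&=P_{\mathbb C}(u_{15})\,U[\delta_3,\,\delta_3F_0+iu_{14}\delta_4]. \end{aligned}$$ **Claim.** Each of the nineteen functions $V_1,\dots,V_{19}$ is a real polynomial in the twenty components of $p,q,a,b,c$ (hence continuous), is invariant under $SO^+(1,3)\times S_2\times S_3$, and is parity-odd,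 $V_i(\mathscr P e)=-V_i(e)$. Moreover, for every chiral collision event $e$ at least one of $V_1(e),\dots,V_{19}(e)$ is non-zero. -/

import Mathlib

namespace Chirality

/-- Real four-vectors `(E, p₁, p₂, p₃)`. -/
abbrev FourVector : Type := Fin 4 → ℝ

/-- Five four-vectors `(p, q, a, b, c)`: the slots `Sum.inl 0, Sum.inl 1` hold `p, q` and the slots
`Sum.inr 0, Sum.inr 1, Sum.inr 2` hold `a, b, c`. -/
abbrev Config : Type := Fin 2 ⊕ Fin 3 → FourVector

/-- The Minkowski product, of signature `(+, -, -, -)`. -/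
def mink (x y : FourVector) : ℝ := x 0 * y 0 - x 1 * y 1 - x 2 * y 2 - x 3 * y 3

/-- The set `𝕍` of forward-directed non-spacelike four-vectors: all `(√(m² + |p|²), p)` with
`m ≥ 0`. It contains the zero vector and the null vectors. -/
def forwardCone : Set FourVector :=
  {p | ∃ m : ℝ, 0 ≤ m ∧ p 0 = Real.sqrt (m ^ 2 + (p 1 ^ 2 + p 2 ^ 2 + p 3 ^ 2))}

/-- The Minkowski metric `diag(1, -1, -1, -1)`. -/
def metric : Matrix (Fin 4) (Fin 4) ℝ := Matrix.diagonal ![1, -1, -1, -1]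

/-- The group `SO⁺(1,3)` of proper orthochronous Lorentz transformations. -/
def SOPlus : Set (Matrix (Fin 4) (Fin 4) ℝ) :=
  {L | L.transpose * metric * L = metric ∧ L.det = 1 ∧ 0 < L 0 0}

/-- The coherent action of a Lorentz transformation on five momenta. -/
def lorentzAct (L : Matrix (Fin 4) (Fin 4) ℝ) (x : Config) : Config := fun k => L.mulVec (x k)

/-- The action of `S₂ × S₃`: `τ` permutes `p, q` and `σ` permutes `a, b, c`. -/
def permAct (τ : Equiv.Perm (Fin 2)) (σ : Equiv.Perm (Fin 3)) (x : Config) : Config :=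
  fun k => x (Equiv.sumCongr τ σ k)

/-- The parity operator `(E, p) ↦ (E, -p)` on one four-vector. -/
def parityVec (p : FourVector) : FourVector := ![p 0, -p 1, -p 2, -p 3]

/-- The parity operator on five momenta. -/
def parity (x : Config) : Config := fun k => parityVec (x k)

/-- `x` and `y` lie on the same orbit of `SO⁺(1,3) × S₂ × S₃`. -/
def Equivalent (x y : Config) : Prop :=
  ∃ L ∈ SOPlus, ∃ (τ : Equiv.Perm (Fin 2)) (σ : Equiv.Perm (Fin 3)),
    x = lorentzAct L (permAct τ σ y)

/-- A chiral event: one that is not equivalent to its own parity image. -/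
def IsChiral (x : Config) : Prop := ¬ Equivalent x (parity x)

/-- A collision event `(pq) → (abc) + X`: all momenta are in `𝕍` and `p² q² < (p.q)²`. -/
def IsCollisionEvent (x : Config) : Prop :=
  (∀ k, x k ∈ forwardCone) ∧
    mink (x (Sum.inl 0)) (x (Sum.inl 0)) * mink (x (Sum.inl 1)) (x (Sum.inl 1)) <
      mink (x (Sum.inl 0)) (x (Sum.inl 1)) ^ 2

/-- The contraction `[a,b,c,d] = ε_{μνστ} a^μ b^ν c^σ d^τ` with the totally antisymmetric symbol
normalised by `ε_{0123} = s`. -/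
def bracket (s : ℝ) (a b c d : FourVector) : ℝ := s * (Matrix.of ![a, b, c, d]).det

/-- The Gram determinant `G(x, l; y, l')` whose rows are `x, l` and whose columns are `y, l'`. -/
def gram (x l y l' : FourVector) : ℝ := !![mink x y, mink x l'; mink l y, mink l l'].det

section Ingredients

variable (s : ℝ) (x : Config)

/-- The momentum `p`. -/
def vp : FourVector := x (Sum.inl 0)
/-- The momentum `q`. -/
def vq : FourVector := x (Sum.inl 1)
/-- The momentum `a`. -/
def va : FourVector := x (Sum.inr 0)
/-- The momentum `b`. -/
def vb : FourVector := x (Sum.inr 1)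
/-- The momentum `c`. -/
def vc : FourVector := x (Sum.inr 2)

/-- `ε^{yz}_{pq} = [y, z, p, q]`. -/
def eps (y z : FourVector) : ℝ := bracket s y z (vp x) (vq x)

/-- `g^y_z = G(y, p+q; z, p+q)`. -/
def g (y z : FourVector) : ℝ := gram y (vp x + vq x) z (vp x + vq x)

/-- `𝒫(1) = ε^{ab} + ε^{bc} + ε^{ca}`. -/
def P1 : ℝ := eps s x (va x) (vb x) + eps s x (vb x) (vc x) + eps s x (vc x) (va x)

/-- `𝒫(2) = ε^{ab} ε^{bc} ε^{ca}`. -/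
def P2 : ℝ := eps s x (va x) (vb x) * eps s x (vb x) (vc x) * eps s x (vc x) (va x)

/-- `𝒫(3) = (ε^{ab} - ε^{bc}) (ε^{bc} - ε^{ca}) (ε^{ca} - ε^{ab})`. -/
def P3 : ℝ :=
  (eps s x (va x) (vb x) - eps s x (vb x) (vc x)) *
    (eps s x (vb x) (vc x) - eps s x (vc x) (va x)) *
      (eps s x (vc x) (va x) - eps s x (va x) (vb x))

/-- `F(0) = p² - q²`. -/
def F0 : ℝ := mink (vp x) (vp x) - mink (vq x) (vq x)

/-- `F(1) = g^{a+b+c}_{p-q}`. -/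
def F1 : ℝ := g x (va x + vb x + vc x) (vp x - vq x)

/-- `F(2) = g^a_{p-q} g^b_{p-q} g^c_{p-q}`. -/
def F2 : ℝ := g x (va x) (vp x - vq x) * g x (vb x) (vp x - vq x) * g x (vc x) (vp x - vq x)

/-- `F(3) = g^{a-b}_{p-q} g^{b-c}_{p-q} g^{c-a}_{p-q}`. -/
def F3 : ℝ :=
  g x (va x - vb x) (vp x - vq x) * g x (vb x - vc x) (vp x - vq x) *
    g x (vc x - va x) (vp x - vq x)

/-- `𝒫(ℂ, u) = 𝒫(1)³ + i u 𝒫(2)`. -/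
def PC (u : ℝ) : ℂ := (P1 s x : ℂ) ^ 3 + Complex.I * u * P2 s x

/-- `F(ℂ, u) = F(1) + i u F(2)`. -/
def FC (u : ℝ) : ℂ := (F1 x : ℂ) + Complex.I * u * F2 x

/-- `δf₁^{yz} = g^y_y - g^z_z`. -/
def df1 (y z : FourVector) : ℝ := g x y y - g x z z

/-- `δf₂^{yz} = g^y_{a+b+c} - g^z_{a+b+c}`. -/
def df2 (y z : FourVector) : ℝ := g x y (va x + vb x + vc x) - g x z (va x + vb x + vc x)

/-- `δf₃^{yz} = y² - z²`. -/
def df3 (y z : FourVector) : ℝ := mink y y - mink z z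

/-- `δf₄^{yz} = g^y_{p-q} - g^z_{p-q}`. -/
def df4 (y z : FourVector) : ℝ := g x y (vp x - vq x) - g x z (vp x - vq x)

/-- `δf₁^{yz} + i u δf₂^{yz}`. -/
def dC (u : ℝ) (y z : FourVector) : ℂ := (df1 x y z : ℂ) + Complex.I * u * df2 x y z

/-- `U[f, h] = f(a,b) f(b,c) h(c,a) + f(a,b) h(b,c) f(c,a) + h(a,b) f(b,c) f(c,a)`. -/
def U (f h : FourVector → FourVector → ℂ) : ℂ :=
  f (va x) (vb x) * f (vb x) (vc x) * h (vc x) (va x) +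
    f (va x) (vb x) * h (vb x) (vc x) * f (vc x) (va x) +
      h (va x) (vb x) * f (vb x) (vc x) * f (vc x) (va x)

end Ingredients

/-- The first five event variables are products of two ingredients. -/
def V1 (s : ℝ) (x : Config) : ℝ := P1 s x * F3 x
def V2 (s : ℝ) (x : Config) : ℝ := P2 s x * F3 x
def V3 (s : ℝ) (x : Config) : ℝ := P3 s x * F0 x
def V4 (s : ℝ) (x : Config) : ℝ := P3 s x * F1 x
def V5 (s : ℝ) (x : Config) : ℝ := P3 s x * F2 x

/-- The summand `𝒫(3) F(3) g^a_{p-q} g^c_{p-q} ((ε^{ab})² - (ε^{cb})²)`, summed over all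
permutations of `a, b, c`. -/
def V6 (s : ℝ) (x : Config) : ℝ :=
  ∑ σ : Equiv.Perm (Fin 3), let y := permAct 1 σ x
    P3 s y * F3 y * g y (va y) (vp y - vq y) * g y (vc y) (vp y - vq y) *
      (eps s y (va y) (vb y) ^ 2 - eps s y (vc y) (vb y) ^ 2)

/-- The summand `𝒫(3) F(3) g^a_{p-q} g^c_{p-q} (a² - c²)`, summed over all permutations of
`a, b, c`. -/
def V7 (s : ℝ) (x : Config) : ℝ :=
  ∑ σ : Equiv.Perm (Fin 3), let y := permAct 1 σ x
    P3 s y * F3 y * g y (va y) (vp y - vq y) * g y (vc y) (vp y - vq y) *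
      (mink (va y) (va y) - mink (vc y) (vc y))

section ComplexVariables

/-! The constants `u₁, …, u₁₅` are `u 0, …, u 14`. -/

variable (s : ℝ) (u : Fin 15 → ℝ) (x : Config)

def v1 : ℂ := PC s x (u 1) * U x (dC x (u 0)) (fun y z => dC x (u 0) y z * FC x (u 2))

def v2 : ℂ := PC s x (u 4) * U x (dC x (u 3)) (fun y z => dC x (u 3) y z * F0 x)

def v3 : ℂ := PC s x (u 7) * U x (dC x (u 5)) (fun y z => df3 y z * FC x (u 6))

def v4 : ℂ :=
  PC s x (u 10) *
    U x (dC x (u 8)) (fun y z => df3 y z * F0 x + Complex.I * u 9 * df4 x y z)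

def v5 : ℂ := PC s x (u 11) * U x (fun y z => df3 y z) (fun y z => df3 y z * FC x (u 12))

def v6 : ℂ :=
  PC s x (u 14) *
    U x (fun y z => df3 y z) (fun y z => df3 y z * F0 x + Complex.I * u 13 * df4 x y z)

end ComplexVariables

/-- The nineteen event variables `V₁, …, V₁₉`, listed as `V 0, …, V 18`. -/
def V (s : ℝ) (u : Fin 15 → ℝ) (i : Fin 19) (x : Config) : ℝ :=
  ![V1 s x, V2 s x, V3 s x, V4 s x, V5 s x, V6 s x, V7 s x,
    (v1 s u x).re, (v1 s u x).im, (v2 s u x).re, (v2 s u x).im,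
    (v3 s u x).re, (v3 s u x).im, (v4 s u x).re, (v4 s u x).im,
    (v5 s u x).re, (v5 s u x).im, (v6 s u x).re, (v6 s u x).im] i

end Chirality

/-! Write P = p + q. For a spacelike vector w, the reflection in the hyperplane orthogonal to w,
composed with parity, is a proper orthochronous Lorentz transformation. So an event is achiral as
soon as a spacelike reflection maps it to a relabelling of itself. Completeness is proved
contrapositively: if all variables vanish, such a mirror exists. In each case its normal w is
non-zero and orthogonal to the timelike vector P, hence spacelike.

If all three brackets vanish, a normal orthogonal to all five momenta exists
(`equivalent_of_eps_eq_zero`). Otherwise P(1), P(2), P(3) are not all zero, since three numbers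
whose sum, product and product of differences vanish are themselves zero. Three cases remain. If
F(3) ≠ 0, then V1, V2 give P(1) = P(2) = 0, so P(3) ≠ 0, and V3, V4, V5 give F(0) = F(1) = F(2) = 0.
With V6, V7 the mirror with normal p - q exchanges p, q and two of a, b, c
(`equivalent_of_exchange`). If F(3) = 0 and P(3) ≠ 0, then F(0), …, F(3) all vanish, so a, b, c are
orthogonal to p - q, and the mirror with normal p - q exchanges only p, q
(`equivalent_of_orthogonal`). If F(3) = P(3) = 0, then the complex combination of P(1) and P(2) is
non-zero. Either F(0), F(1), F(2) vanish and the previous mirror works, or the sums U vanish and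
`difference_values` produces a pair among a, b, c whose four differences are all zero; the mirror
with normal their difference exchanges them (`equivalent_of_differences`).

Invariance is bookkeeping of signs: each variable is odd in the brackets, so an isometry contributes
its determinant, while the signs of the permutations of p, q and of a, b, c cancel. Polynomiality is
closure under ring operations. -/

namespace Chirality

open Equiv

/-! ### The Minkowski product and the bracket -/

theorem mink_comm (x y : FourVector) : mink x y = mink y x := by
  simp only [mink]; ring

theorem mink_add_left (x y z : FourVector) : mink (x + y) z = mink x z + mink y z := by
  simp only [mink, Pi.add_apply]; ring

theorem mink_add_right (x y z : FourVector) : mink x (y + z) = mink x y + mink x z := by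
  simp only [mink, Pi.add_apply]; ring

theorem mink_sub_left (x y z : FourVector) : mink (x - y) z = mink x z - mink y z := by
  simp only [mink, Pi.sub_apply]; ring

theorem mink_sub_right (x y z : FourVector) : mink x (y - z) = mink x y - mink x z := by
  simp only [mink, Pi.sub_apply]; ring

theorem mink_smul_left (t : ℝ) (x y : FourVector) : mink (t • x) y = t * mink x y := by
  simp only [mink, Pi.smul_apply, smul_eq_mul]; ring

theorem mink_smul_right (t : ℝ) (x y : FourVector) : mink x (t • y) = t * mink x y := by
  simp only [mink, Pi.smul_apply, smul_eq_mul]; ring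

theorem bracket_eq (s : ℝ) (a b c d : FourVector) :
    bracket s a b c d = s *
      ((a 0 * b 1 - a 1 * b 0) * (c 2 * d 3 - c 3 * d 2)
        - (a 0 * b 2 - a 2 * b 0) * (c 1 * d 3 - c 3 * d 1)
        + (a 0 * b 3 - a 3 * b 0) * (c 1 * d 2 - c 2 * d 1)
        + (a 1 * b 2 - a 2 * b 1) * (c 0 * d 3 - c 3 * d 0)
        - (a 1 * b 3 - a 3 * b 1) * (c 0 * d 2 - c 2 * d 0)
        + (a 2 * b 3 - a 3 * b 2) * (c 0 * d 1 - c 1 * d 0)) := by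
  rw [bracket]
  congr 1
  simp [Matrix.det_succ_row_zero, Fin.sum_univ_succ, Fin.succAbove]
  ring

theorem gram_eq (x l y l' : FourVector) :
    gram x l y l' = mink x y * mink l l' - mink x l' * mink l y := by
  simp [gram, Matrix.det_fin_two]

theorem g_eq (x : Config) (y z : FourVector) :
    g x y z = mink y z * mink (vp x + vq x) (vp x + vq x)
      - mink y (vp x + vq x) * mink (vp x + vq x) z := by
  rw [g, gram_eq]

theorem g_add_left (x : Config) (y y' z : FourVector) : g x (y + y') z = g x y z + g x y' z := by
  simp only [g_eq, mink_add_left y y']; ring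

theorem g_sub_left (x : Config) (y y' z : FourVector) : g x (y - y') z = g x y z - g x y' z := by
  simp only [g_eq, mink_sub_left y y']; ring

theorem eps_swap (s : ℝ) (x : Config) (y z : FourVector) : eps s x y z = -eps s x z y := by
  simp only [eps, bracket_eq]; ring

theorem eps_sub_left (s : ℝ) (x : Config) (y y' z : FourVector) :
    eps s x (y - y') z = eps s x y z - eps s x y' z := by
  simp only [eps, bracket_eq, Pi.sub_apply]; ring

theorem eps_self (s : ℝ) (x : Config) (y : FourVector) : eps s x y y = 0 := by
  simp only [eps, bracket_eq]; ring

/-- A property which holds for all the real event variables and for the real and imaginary parts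
of all the complex ones holds for each `V s u i`. -/
theorem forall_V {P : (Config → ℝ) → Prop} (s : ℝ) (u : Fin 15 → ℝ)
    (h1 : P (V1 s)) (h2 : P (V2 s)) (h3 : P (V3 s)) (h4 : P (V4 s)) (h5 : P (V5 s))
    (h6 : P (V6 s)) (h7 : P (V7 s))
    (k1 : P (fun x => (v1 s u x).re) ∧ P (fun x => (v1 s u x).im))
    (k2 : P (fun x => (v2 s u x).re) ∧ P (fun x => (v2 s u x).im))
    (k3 : P (fun x => (v3 s u x).re) ∧ P (fun x => (v3 s u x).im))
    (k4 : P (fun x => (v4 s u x).re) ∧ P (fun x => (v4 s u x).im))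
    (k5 : P (fun x => (v5 s u x).re) ∧ P (fun x => (v5 s u x).im))
    (k6 : P (fun x => (v6 s u x).re) ∧ P (fun x => (v6 s u x).im)) (i : Fin 19) :
    P (V s u i) := by
  fin_cases i
  exacts [h1, h2, h3, h4, h5, h6, h7, k1.1, k1.2, k2.1, k2.2, k3.1, k3.2, k4.1, k4.2, k5.1, k5.2,
    k6.1, k6.2]

/-! ### Behaviour under linear isometries -/

section Isometry

variable {M : Matrix (Fin 4) (Fin 4) ℝ}

@[simp] theorem vp_lorentzAct (x : Config) : vp (lorentzAct M x) = M.mulVec (vp x) := rfl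
@[simp] theorem vq_lorentzAct (x : Config) : vq (lorentzAct M x) = M.mulVec (vq x) := rfl
@[simp] theorem va_lorentzAct (x : Config) : va (lorentzAct M x) = M.mulVec (va x) := rfl
@[simp] theorem vb_lorentzAct (x : Config) : vb (lorentzAct M x) = M.mulVec (vb x) := rfl
@[simp] theorem vc_lorentzAct (x : Config) : vc (lorentzAct M x) = M.mulVec (vc x) := rfl

theorem bracket_mulVec (s : ℝ) (a b c d : FourVector) :
    bracket s (M.mulVec a) (M.mulVec b) (M.mulVec c) (M.mulVec d)
      = M.det * bracket s a b c d := by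
  have : Matrix.of ![M.mulVec a, M.mulVec b, M.mulVec c, M.mulVec d]
      = Matrix.of ![a, b, c, d] * M.transpose := by
    ext i j
    fin_cases i <;> simp [Matrix.mul_apply, Matrix.mulVec, dotProduct, mul_comm]
  rw [bracket, this, Matrix.det_mul, Matrix.det_transpose, bracket]; ring

theorem eps_lorentzAct (s : ℝ) (x : Config) (y z : FourVector) :
    eps s (lorentzAct M x) (M.mulVec y) (M.mulVec z) = M.det * eps s x y z :=
  bracket_mulVec _ _ _ _ _

theorem P1_lorentzAct (s : ℝ) (x : Config) : P1 s (lorentzAct M x) = M.det * P1 s x := by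
  simp only [P1, va_lorentzAct, vb_lorentzAct, vc_lorentzAct, eps_lorentzAct]; ring

theorem P2_lorentzAct (s : ℝ) (x : Config) : P2 s (lorentzAct M x) = M.det ^ 3 * P2 s x := by
  simp only [P2, va_lorentzAct, vb_lorentzAct, vc_lorentzAct, eps_lorentzAct]; ring

theorem P3_lorentzAct (s : ℝ) (x : Config) : P3 s (lorentzAct M x) = M.det ^ 3 * P3 s x := by
  simp only [P3, va_lorentzAct, vb_lorentzAct, vc_lorentzAct, eps_lorentzAct]; ring

theorem PC_lorentzAct (s u : ℝ) (x : Config) :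
    PC s (lorentzAct M x) u = (M.det : ℂ) ^ 3 * PC s x u := by
  simp only [PC, P1_lorentzAct, P2_lorentzAct]; push_cast; ring

theorem permAct_lorentzAct (τ : Perm (Fin 2)) (σ : Perm (Fin 3)) (x : Config) :
    permAct τ σ (lorentzAct M x) = lorentzAct M (permAct τ σ x) := rfl

theorem g_lorentzAct (hM : ∀ y z, mink (M.mulVec y) (M.mulVec z) = mink y z)
    (x : Config) (y z : FourVector) :
    g (lorentzAct M x) (M.mulVec y) (M.mulVec z) = g x y z := by
  simp only [g_eq, vp_lorentzAct, vq_lorentzAct, ← Matrix.mulVec_add, hM]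

/-- An isometry of determinant `±1` multiplies each event variable by its determinant. -/
theorem V_lorentzAct (hM : ∀ y z, mink (M.mulVec y) (M.mulVec z) = mink y z)
    (hdet : M.det ^ 2 = 1) (s : ℝ) (u : Fin 15 → ℝ) (i : Fin 19) (x : Config) :
    V s u i (lorentzAct M x) = M.det * V s u i x := by
  have hd3 : M.det ^ 3 = M.det := by rw [pow_succ, hdet, one_mul]
  have hd3' : (M.det : ℂ) ^ 3 = M.det := by exact_mod_cast congrArg (fun r : ℝ => (r : ℂ)) hd3
  have hF0 (x) : F0 (lorentzAct M x) = F0 x := by simp [F0, hM]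
  have hF1 (x) : F1 (lorentzAct M x) = F1 x := by
    simp only [F1, vp_lorentzAct, vq_lorentzAct, va_lorentzAct, vb_lorentzAct, vc_lorentzAct,
      ← Matrix.mulVec_add, ← Matrix.mulVec_sub, g_lorentzAct hM]
  have hF2 (x) : F2 (lorentzAct M x) = F2 x := by
    simp only [F2, vp_lorentzAct, vq_lorentzAct, va_lorentzAct, vb_lorentzAct, vc_lorentzAct,
      ← Matrix.mulVec_sub, g_lorentzAct hM]
  have hF3 (x) : F3 (lorentzAct M x) = F3 x := by
    simp only [F3, vp_lorentzAct, vq_lorentzAct, va_lorentzAct, vb_lorentzAct, vc_lorentzAct,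
      ← Matrix.mulVec_sub, g_lorentzAct hM]
  have hFC (x w) : FC (lorentzAct M x) w = FC x w := by simp only [FC, hF1, hF2]
  have hdC (x w y z) : dC (lorentzAct M x) w (M.mulVec y) (M.mulVec z) = dC x w y z := by
    simp only [dC, df1, df2, va_lorentzAct, vb_lorentzAct, vc_lorentzAct,
      ← Matrix.mulVec_add, g_lorentzAct hM]
  have hd3v (y z) : df3 (M.mulVec y) (M.mulVec z) = df3 y z := by simp only [df3, hM]
  have hd4 (x y z) : df4 (lorentzAct M x) (M.mulVec y) (M.mulVec z) = df4 x y z := by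
    simp only [df4, vp_lorentzAct, vq_lorentzAct, ← Matrix.mulVec_sub, g_lorentzAct hM]
  have re_mul {z w : ℂ} (h : z = M.det * w) : z.re = M.det * w.re ∧ z.im = M.det * w.im := by
    rw [h, Complex.re_ofReal_mul, Complex.im_ofReal_mul]; exact ⟨rfl, rfl⟩
  refine forall_V (P := fun f => f (lorentzAct M x) = M.det * f x) s u ?_ ?_ ?_ ?_ ?_ ?_ ?_
    (re_mul ?_) (re_mul ?_) (re_mul ?_) (re_mul ?_) (re_mul ?_) (re_mul ?_) i
  · simp only [V1, P1_lorentzAct, hF3, mul_assoc]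
  · simp only [V2, P2_lorentzAct, hd3, hF3, mul_assoc]
  · simp only [V3, P3_lorentzAct, hd3, hF0, mul_assoc]
  · simp only [V4, P3_lorentzAct, hd3, hF1, mul_assoc]
  · simp only [V5, P3_lorentzAct, hd3, hF2, mul_assoc]
  · simp only [V6, permAct_lorentzAct, P3_lorentzAct, hd3, hF3, eps_lorentzAct, vp_lorentzAct,
      vq_lorentzAct, va_lorentzAct, vb_lorentzAct, vc_lorentzAct, ← Matrix.mulVec_sub,
      g_lorentzAct hM, mul_pow, hdet, one_mul, Finset.mul_sum, mul_assoc]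
  · simp only [V7, permAct_lorentzAct, P3_lorentzAct, hd3, hF3, vp_lorentzAct, hM,
      vq_lorentzAct, va_lorentzAct, vc_lorentzAct, ← Matrix.mulVec_sub,
      g_lorentzAct hM, Finset.mul_sum, mul_assoc]
  · simp only [v1, U, PC_lorentzAct, hd3', hFC, hdC,
      va_lorentzAct, vb_lorentzAct, vc_lorentzAct, mul_assoc]
  · simp only [v2, U, PC_lorentzAct, hd3', hF0, hdC,
      va_lorentzAct, vb_lorentzAct, vc_lorentzAct, mul_assoc]
  · simp only [v3, U, PC_lorentzAct, hd3', hFC, hdC, hd3v,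
      va_lorentzAct, vb_lorentzAct, vc_lorentzAct, mul_assoc]
  · simp only [v4, U, PC_lorentzAct, hd3', hF0, hdC, hd3v, hd4,
      va_lorentzAct, vb_lorentzAct, vc_lorentzAct, mul_assoc]
  · simp only [v5, U, PC_lorentzAct, hd3', hFC, hd3v,
      va_lorentzAct, vb_lorentzAct, vc_lorentzAct, mul_assoc]
  · simp only [v6, U, PC_lorentzAct, hd3', hF0, hd3v, hd4,
      va_lorentzAct, vb_lorentzAct, vc_lorentzAct, mul_assoc]

end Isometry

/-! ### Behaviour under permutations -/

/-- The sign of a permutation as a real number. -/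
noncomputable def sgn {n : ℕ} (σ : Perm (Fin n)) : ℝ := ((Perm.sign σ : ℤ) : ℝ)

theorem sgn_sq {n : ℕ} (σ : Perm (Fin n)) : sgn σ * sgn σ = 1 := by
  rcases Int.units_eq_one_or (Perm.sign σ) with h | h <;> simp [sgn, h]

theorem perm_two_cases (τ : Perm (Fin 2)) : τ = 1 ∨ τ = swap 0 1 := by
  revert τ; decide

theorem perm_three_cases (σ : Perm (Fin 3)) :
    σ = 1 ∨ σ = swap 0 1 ∨ σ = swap 1 2 ∨ σ = swap 0 2 ∨ σ = swap 0 1 * swap 1 2 ∨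
      σ = swap 1 2 * swap 0 1 := by
  revert σ; decide

theorem sum_perm_three {α : Type*} [AddCommMonoid α] (f : Perm (Fin 3) → α) :
    ∑ σ, f σ = f 1 + (f (swap 0 1) + (f (swap 1 2) + (f (swap 0 2) +
      (f (swap 0 1 * swap 1 2) + f (swap 1 2 * swap 0 1))))) := by
  have : (Finset.univ : Finset (Perm (Fin 3))) =
      {1, swap 0 1, swap 1 2, swap 0 2, swap 0 1 * swap 1 2, swap 1 2 * swap 0 1} := by
    decide
  rw [this, Finset.sum_insert (by decide), Finset.sum_insert (by decide),
    Finset.sum_insert (by decide), Finset.sum_insert (by decide),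
    Finset.sum_insert (by decide), Finset.sum_singleton]

section Permutation

variable (s : ℝ) (τ : Perm (Fin 2)) (σ : Perm (Fin 3)) (x : Config)

theorem va_permAct : va (permAct τ σ x) = x (Sum.inr (σ 0)) := rfl
theorem vb_permAct : vb (permAct τ σ x) = x (Sum.inr (σ 1)) := rfl
theorem vc_permAct : vc (permAct τ σ x) = x (Sum.inr (σ 2)) := rfl

/-- Bundling the sign with the relabelled triple lets one case split supply both, so each
ingredient's sign law becomes six polynomial identities. -/
theorem abc_permAct : (va (permAct τ σ x), vb (permAct τ σ x), vc (permAct τ σ x), sgn σ) ∈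
    ({(va x, vb x, vc x, 1), (vb x, va x, vc x, -1), (va x, vc x, vb x, -1),
      (vc x, vb x, va x, -1), (vb x, vc x, va x, 1), (vc x, va x, vb x, 1)} :
      Set (FourVector × FourVector × FourVector × ℝ)) := by
  have h02 : (2 : Fin 3) ≠ 0 := by decide
  have h12 : (2 : Fin 3) ≠ 1 := by decide
  rcases perm_three_cases σ with rfl | rfl | rfl | rfl | rfl | rfl <;>
    simp [va, vb, vc, permAct, sgn, swap_apply_def, h02, h12]

theorem pq_permAct : (vp (permAct τ σ x), vq (permAct τ σ x), sgn τ) ∈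
    ({(vp x, vq x, 1), (vq x, vp x, -1)} : Set (FourVector × FourVector × ℝ)) := by
  rcases perm_two_cases τ with rfl | rfl <;> simp [vp, vq, permAct, sgn]

end Permutation

/-! ### Sign laws of the ingredients under permutations -/

section PermutationInvariance

variable (s : ℝ) (τ : Perm (Fin 2)) (σ : Perm (Fin 3)) (x : Config)

theorem sgn_eq {n : ℕ} (σ : Perm (Fin n)) : sgn σ = 1 ∨ sgn σ = -1 := by
  rcases Int.units_eq_one_or (Perm.sign σ) with h | h <;> simp [sgn, h]

theorem sgn_one {n : ℕ} : sgn (1 : Perm (Fin n)) = 1 := by simp [sgn]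

theorem vp_add_vq_permAct : vp (permAct τ σ x) + vq (permAct τ σ x) = vp x + vq x := by
  have h := pq_permAct τ σ x
  simp only [Set.mem_insert_iff, Set.mem_singleton_iff, Prod.mk.injEq] at h
  rcases h with ⟨h1, h2, -⟩ | ⟨h1, h2, -⟩ <;> rw [h1, h2]
  exact add_comm _ _

theorem vp_sub_vq_permAct :
    vp (permAct τ σ x) - vq (permAct τ σ x) = sgn τ • (vp x - vq x) := by
  have h := pq_permAct τ σ x
  simp only [Set.mem_insert_iff, Set.mem_singleton_iff, Prod.mk.injEq] at h
  rcases h with ⟨h1, h2, h3⟩ | ⟨h1, h2, h3⟩ <;> rw [h1, h2, h3] <;> simp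

theorem abc_sum_permAct : va (permAct τ σ x) + vb (permAct τ σ x) + vc (permAct τ σ x)
    = va x + vb x + vc x := by
  have h := abc_permAct τ σ x
  simp only [Set.mem_insert_iff, Set.mem_singleton_iff, Prod.mk.injEq] at h
  rcases h with ⟨h1, h2, h3, -⟩ | ⟨h1, h2, h3, -⟩ | ⟨h1, h2, h3, -⟩ | ⟨h1, h2, h3, -⟩ |
    ⟨h1, h2, h3, -⟩ | ⟨h1, h2, h3, -⟩ <;> rw [h1, h2, h3] <;> abel

theorem g_permAct (y z : FourVector) : g (permAct τ σ x) y z = g x y z := by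
  rw [g, vp_add_vq_permAct, g]

theorem g_smul_right (t : ℝ) (y z : FourVector) : g x y (t • z) = t * g x y z := by
  simp only [g_eq, mink_smul_right]; ring

theorem eps_permAct (y z : FourVector) : eps s (permAct τ σ x) y z = sgn τ * eps s x y z := by
  have h := pq_permAct τ σ x
  simp only [Set.mem_insert_iff, Set.mem_singleton_iff, Prod.mk.injEq] at h
  rcases h with ⟨h1, h2, h3⟩ | ⟨h1, h2, h3⟩ <;> 
    simp only [eps, h1, h2, h3, bracket_eq] <;> ring

theorem P1_permAct : P1 s (permAct τ σ x) = sgn τ * sgn σ * P1 s x := by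
  have h := abc_permAct τ σ x
  simp only [Set.mem_insert_iff, Set.mem_singleton_iff, Prod.mk.injEq] at h
  simp only [P1, eps_permAct]
  have e1 := eps_swap s x (vb x) (va x)
  have e2 := eps_swap s x (vc x) (vb x)
  have e3 := eps_swap s x (va x) (vc x)
  rcases h with ⟨h1, h2, h3, h4⟩ | ⟨h1, h2, h3, h4⟩ | ⟨h1, h2, h3, h4⟩ | ⟨h1, h2, h3, h4⟩ |
    ⟨h1, h2, h3, h4⟩ | ⟨h1, h2, h3, h4⟩ <;> simp only [h1, h2, h3, h4, e1, e2, e3] <;> ring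

theorem P2_permAct : P2 s (permAct τ σ x) = sgn τ * sgn σ * P2 s x := by
  have h := abc_permAct τ σ x
  simp only [Set.mem_insert_iff, Set.mem_singleton_iff, Prod.mk.injEq] at h
  simp only [P2, eps_permAct]
  have e1 := eps_swap s x (vb x) (va x)
  have e2 := eps_swap s x (vc x) (vb x)
  have e3 := eps_swap s x (va x) (vc x)
  rcases sgn_eq τ with ht | ht <;>
  rcases h with ⟨h1, h2, h3, h4⟩ | ⟨h1, h2, h3, h4⟩ | ⟨h1, h2, h3, h4⟩ | ⟨h1, h2, h3, h4⟩ |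
    ⟨h1, h2, h3, h4⟩ | ⟨h1, h2, h3, h4⟩ <;> simp only [ht, h1, h2, h3, h4, e1, e2, e3] <;> ring

/-- A permutation of a, b, c permutes the three brackets and multiplies each by its sign. The
product of differences contributes the sign a second time, so it cancels here, unlike in `P1` and
`P2`. -/
theorem P3_permAct : P3 s (permAct τ σ x) = sgn τ * P3 s x := by
  have h := abc_permAct τ σ x
  simp only [Set.mem_insert_iff, Set.mem_singleton_iff, Prod.mk.injEq] at h
  simp only [P3, eps_permAct]
  have e1 := eps_swap s x (vb x) (va x)
  have e2 := eps_swap s x (vc x) (vb x)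
  have e3 := eps_swap s x (va x) (vc x)
  rcases sgn_eq τ with ht | ht <;>
  rcases h with ⟨h1, h2, h3, h4⟩ | ⟨h1, h2, h3, h4⟩ | ⟨h1, h2, h3, h4⟩ | ⟨h1, h2, h3, h4⟩ |
    ⟨h1, h2, h3, h4⟩ | ⟨h1, h2, h3, h4⟩ <;> simp only [ht, h1, h2, h3, e1, e2, e3] <;> ring

theorem F0_permAct : F0 (permAct τ σ x) = sgn τ * F0 x := by
  have h := pq_permAct τ σ x
  simp only [Set.mem_insert_iff, Set.mem_singleton_iff, Prod.mk.injEq] at h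
  simp only [F0]
  rcases h with ⟨h1, h2, h3⟩ | ⟨h1, h2, h3⟩ <;> rw [h1, h2, h3] <;> ring

theorem F1_permAct : F1 (permAct τ σ x) = sgn τ * F1 x := by
  simp only [F1, abc_sum_permAct, vp_sub_vq_permAct, g_permAct, g_smul_right]

theorem F2_permAct : F2 (permAct τ σ x) = sgn τ * F2 x := by
  have h := abc_permAct τ σ x
  simp only [Set.mem_insert_iff, Set.mem_singleton_iff, Prod.mk.injEq] at h
  simp only [F2, vp_sub_vq_permAct, g_permAct, g_smul_right]
  rcases sgn_eq τ with ht | ht <;>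
  rcases h with ⟨h1, h2, h3, -⟩ | ⟨h1, h2, h3, -⟩ | ⟨h1, h2, h3, -⟩ | ⟨h1, h2, h3, -⟩ |
    ⟨h1, h2, h3, -⟩ | ⟨h1, h2, h3, -⟩ <;> simp only [ht, h1, h2, h3] <;> ring

theorem F3_permAct : F3 (permAct τ σ x) = sgn τ * sgn σ * F3 x := by
  have h := abc_permAct τ σ x
  simp only [Set.mem_insert_iff, Set.mem_singleton_iff, Prod.mk.injEq] at h
  simp only [F3, vp_sub_vq_permAct, g_permAct, g_smul_right, g_sub_left]
  rcases sgn_eq τ with ht | ht <;>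
  rcases h with ⟨h1, h2, h3, h4⟩ | ⟨h1, h2, h3, h4⟩ | ⟨h1, h2, h3, h4⟩ | ⟨h1, h2, h3, h4⟩ |
    ⟨h1, h2, h3, h4⟩ | ⟨h1, h2, h3, h4⟩ <;> simp only [ht, h1, h2, h3, h4] <;> ring

theorem PC_permAct (w : ℝ) : PC s (permAct τ σ x) w = (sgn τ * sgn σ : ℝ) * PC s x w := by
  simp only [PC, P1_permAct, P2_permAct]
  rcases sgn_eq τ with ht | ht <;> rcases sgn_eq σ with hs | hs <;> simp only [ht, hs] <;>
    push_cast <;> ring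

theorem FC_permAct (w : ℝ) : FC (permAct τ σ x) w = (sgn τ : ℝ) * FC x w := by
  simp only [FC, F1_permAct, F2_permAct]
  push_cast; ring

theorem dC_permAct (w : ℝ) (y z : FourVector) : dC (permAct τ σ x) w y z = dC x w y z := by
  simp only [dC, df1, df2, abc_sum_permAct, g_permAct]

theorem df4_permAct (y z : FourVector) : df4 (permAct τ σ x) y z = sgn τ * df4 x y z := by
  simp only [df4, vp_sub_vq_permAct, g_permAct, g_smul_right]; ring

/-- Relabelling permutes the cyclic pairs ab, bc, ca and reverses all of them when it is odd. `U` is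
symmetric in the pairs, and three antisymmetric factors leave one sign. -/
theorem U_permAct {f h : FourVector → FourVector → ℂ} (hf : ∀ y z, f y z = -f z y)
    (hh : ∀ y z, h y z = -h z y) : U (permAct τ σ x) f h = (sgn σ : ℝ) * U x f h := by
  have k := abc_permAct τ σ x
  simp only [Set.mem_insert_iff, Set.mem_singleton_iff, Prod.mk.injEq] at k
  have e1 := hf (vb x) (va x)
  have e2 := hf (vc x) (vb x)
  have e3 := hf (va x) (vc x)
  have e4 := hh (vb x) (va x)
  have e5 := hh (vc x) (vb x)
  have e6 := hh (va x) (vc x)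
  simp only [U]
  rcases k with ⟨h1, h2, h3, h4⟩ | ⟨h1, h2, h3, h4⟩ | ⟨h1, h2, h3, h4⟩ | ⟨h1, h2, h3, h4⟩ |
    ⟨h1, h2, h3, h4⟩ | ⟨h1, h2, h3, h4⟩ <;>
    simp only [h1, h2, h3, h4, e1, e2, e3, e4, e5, e6] <;> push_cast <;> ring

theorem U_mul_right (t : ℂ) (f h : FourVector → FourVector → ℂ) :
    U x f (fun y z => t * h y z) = t * U x f h := by
  simp only [U]; ring

theorem dC_swap (w : ℝ) (y z : FourVector) : dC x w y z = -dC x w z y := by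
  simp only [dC, df1, df2]; push_cast; ring

theorem df3_swap (y z : FourVector) : (df3 y z : ℂ) = -df3 z y := by
  simp only [df3]; push_cast; ring

theorem df4_swap (y z : FourVector) : (df4 x y z : ℂ) = -df4 x z y := by
  simp only [df4]; push_cast; ring

theorem V_permAct (u : Fin 15 → ℝ) (i : Fin 19) :
    V s u i (permAct τ σ x) = V s u i x := by
  have hτ := sgn_sq τ
  have hσ := sgn_sq σ
  have hτσ : ((sgn τ * sgn σ : ℝ) : ℂ) * ((sgn σ : ℝ) * (sgn τ : ℝ)) = 1 := by
    rcases sgn_eq τ with ht | ht <;> rcases sgn_eq σ with hs | hs <;> simp [ht, hs]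
  -- Relabellings act by precomposition, so ρ lands to the right of σ; the sum over ρ is then
  -- reindexed by left multiplication with σ.
  have hcomp (ρ : Perm (Fin 3)) :
      permAct 1 ρ (permAct τ σ x) = permAct τ 1 (permAct 1 (σ * ρ) x) := by
    funext k
    rcases k with k | k <;> rfl
  -- Both signs come from the prefactor, the sign of σ again from `U`, and the sign of τ again from
  -- the second argument of `U`.
  have cancel {f h h' : FourVector → FourVector → ℂ} {c c' : ℂ}
      (hc : c' = (sgn τ * sgn σ : ℝ) * c) (hf : ∀ y z, f y z = -f z y)
      (hh : ∀ y z, h y z = -h z y) (hh' : h' = fun y z => (sgn τ : ℂ) * h y z) :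
      c' * U (permAct τ σ x) f h' = c * U x f h := by
    rw [hc, hh', U_mul_right, U_permAct τ σ x hf hh]
    linear_combination (c * U x f h) * hτσ
  have re_eq {z w : ℂ} (h : z = w) : z.re = w.re ∧ z.im = w.im := by
    rw [h]; exact ⟨rfl, rfl⟩
  have hD (w : ℝ) : dC (permAct τ σ x) w = dC x w :=
    funext fun y => funext fun z => dC_permAct τ σ x w y z
  refine forall_V (P := fun f => f (permAct τ σ x) = f x) s u ?_ ?_ ?_ ?_ ?_ ?_ ?_
    (re_eq ?_) (re_eq ?_) (re_eq ?_) (re_eq ?_) (re_eq ?_) (re_eq ?_) i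
  · simp only [V1, P1_permAct, F3_permAct]
    linear_combination (P1 s x * F3 x) * (sgn σ * sgn σ * hτ + hσ)
  · simp only [V2, P2_permAct, F3_permAct]
    linear_combination (P2 s x * F3 x) * (sgn σ * sgn σ * hτ + hσ)
  · simp only [V3, P3_permAct, F0_permAct]
    linear_combination (P3 s x * F0 x) * hτ
  · simp only [V4, P3_permAct, F1_permAct]
    linear_combination (P3 s x * F1 x) * hτ
  · simp only [V5, P3_permAct, F2_permAct]
    linear_combination (P3 s x * F2 x) * hτ
  · simp only [V6, hcomp]
    rw [← Equiv.sum_comp (Equiv.mulLeft σ) (fun ρ => P3 s (permAct 1 ρ x) * _ * _ * _ * _)]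
    refine Finset.sum_congr rfl fun ρ _ => ?_
    simp only [Equiv.coe_mulLeft]
    generalize permAct 1 (σ * ρ) x = y
    have ha : va (permAct τ 1 y) = va y := rfl
    have hb : vb (permAct τ 1 y) = vb y := rfl
    have hc : vc (permAct τ 1 y) = vc y := rfl
    simp only [P3_permAct, F3_permAct, vp_sub_vq_permAct, g_permAct, g_smul_right, eps_permAct,
      ha, hb, hc]
    rcases sgn_eq τ with ht | ht <;> simp only [ht, sgn_one] <;> ring
  · simp only [V7, hcomp]
    rw [← Equiv.sum_comp (Equiv.mulLeft σ) (fun ρ => P3 s (permAct 1 ρ x) * _ * _ * _ * _)]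
    refine Finset.sum_congr rfl fun ρ _ => ?_
    simp only [Equiv.coe_mulLeft]
    generalize permAct 1 (σ * ρ) x = y
    have ha : va (permAct τ 1 y) = va y := rfl
    have hc : vc (permAct τ 1 y) = vc y := rfl
    simp only [P3_permAct, F3_permAct, vp_sub_vq_permAct, g_permAct, g_smul_right, ha, hc]
    rcases sgn_eq τ with ht | ht <;> simp only [ht, sgn_one] <;> ring
  · simp only [v1, hD]
    refine cancel (PC_permAct s τ σ x _) (dC_swap x _)
      (h := fun y z => dC x (u 0) y z * FC x (u 2)) (fun y z => ?_) (funext fun y => funext fun z => ?_)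
    · rw [dC_swap]; ring
    · simp only [FC_permAct]; ring
  · simp only [v2, hD]
    refine cancel (PC_permAct s τ σ x _) (dC_swap x _)
      (h := fun y z => dC x (u 3) y z * F0 x) (fun y z => ?_) (funext fun y => funext fun z => ?_)
    · rw [dC_swap]; ring
    · simp only [F0_permAct]; push_cast; ring
  · simp only [v3, hD]
    refine cancel (PC_permAct s τ σ x _) (dC_swap x _)
      (h := fun y z => df3 y z * FC x (u 6)) (fun y z => ?_) (funext fun y => funext fun z => ?_)
    · rw [df3_swap]; ring
    · simp only [FC_permAct]; ring
  · simp only [v4, hD]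
    refine cancel (PC_permAct s τ σ x _) (dC_swap x _)
      (h := fun y z => df3 y z * F0 x + Complex.I * u 9 * df4 x y z) (fun y z => ?_) (funext fun y => funext fun z => ?_)
    · rw [df3_swap, df4_swap]; ring
    · simp only [F0_permAct, df4_permAct]; push_cast; ring
  · simp only [v5]
    refine cancel (PC_permAct s τ σ x _) df3_swap
      (h := fun y z => df3 y z * FC x (u 12)) (fun y z => ?_) (funext fun y => funext fun z => ?_)
    · rw [df3_swap]; ring
    · simp only [FC_permAct]; ring
  · simp only [v6]
    refine cancel (PC_permAct s τ σ x _) df3_swap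
      (h := fun y z => df3 y z * F0 x + Complex.I * u 13 * df4 x y z) (fun y z => ?_) (funext fun y => funext fun z => ?_)
    · rw [df3_swap, df4_swap]; ring
    · simp only [F0_permAct, df4_permAct]; push_cast; ring

end PermutationInvariance

/-! ### Polynomiality -/

/-- The function `f` is a real polynomial in the twenty components of the five four-vectors. -/
def IsPoly (f : Config → ℝ) : Prop :=
  ∃ Q : MvPolynomial ((Fin 2 ⊕ Fin 3) × Fin 4) ℝ, ∀ x : Config,
    f x = MvPolynomial.eval (fun k => x k.1 k.2) Q

/-- The real and imaginary parts of `f` are real polynomials in the twenty components. -/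
def IsPolyC (f : Config → ℂ) : Prop := IsPoly (fun x => (f x).re) ∧ IsPoly (fun x => (f x).im)

/-- The components of the vector-valued function `f` are polynomials. -/
def IsPolyVec (f : Config → FourVector) : Prop := ∀ μ, IsPoly (fun x => f x μ)

namespace IsPoly

variable {f h : Config → ℝ}

theorem const (r : ℝ) : IsPoly (fun _ => r) := ⟨MvPolynomial.C r, fun x => by simp⟩

theorem add (hf : IsPoly f) (hh : IsPoly h) : IsPoly (fun x => f x + h x) := by
  obtain ⟨A, hA⟩ := hf
  obtain ⟨B, hB⟩ := hh
  exact ⟨A + B, fun x => by simp [hA, hB]⟩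

theorem sub (hf : IsPoly f) (hh : IsPoly h) : IsPoly (fun x => f x - h x) := by
  obtain ⟨A, hA⟩ := hf
  obtain ⟨B, hB⟩ := hh
  exact ⟨A - B, fun x => by simp [hA, hB]⟩

theorem mul (hf : IsPoly f) (hh : IsPoly h) : IsPoly (fun x => f x * h x) := by
  obtain ⟨A, hA⟩ := hf
  obtain ⟨B, hB⟩ := hh
  exact ⟨A * B, fun x => by simp [hA, hB]⟩

theorem pow (hf : IsPoly f) (n : ℕ) : IsPoly (fun x => f x ^ n) := by
  obtain ⟨A, hA⟩ := hf
  exact ⟨A ^ n, fun x => by simp [hA]⟩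

theorem sum {ι : Type*} (t : Finset ι) {f : ι → Config → ℝ} (hf : ∀ i, IsPoly (f i)) :
    IsPoly (fun x => ∑ i ∈ t, f i x) := by
  choose A hA using hf
  exact ⟨∑ i ∈ t, A i, fun x => by simp [hA, map_sum]⟩

theorem ofReal (hf : IsPoly f) : IsPolyC (fun x => (f x : ℂ)) :=
  ⟨by simpa using hf, by simpa using const 0⟩

theorem continuous (hf : IsPoly f) : Continuous f := by
  obtain ⟨A, hA⟩ := hf
  rw [show f = fun x => MvPolynomial.eval (fun k => x k.1 k.2) A from funext hA]
  have := MvPolynomial.continuous_eval A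
  fun_prop

end IsPoly

namespace IsPolyC

variable {f h : Config → ℂ}

theorem const (r : ℂ) : IsPolyC (fun _ => r) := ⟨IsPoly.const _, IsPoly.const _⟩

theorem add (hf : IsPolyC f) (hh : IsPolyC h) : IsPolyC (fun x => f x + h x) :=
  ⟨hf.1.add hh.1, hf.2.add hh.2⟩

theorem mul (hf : IsPolyC f) (hh : IsPolyC h) : IsPolyC (fun x => f x * h x) :=
  ⟨by simpa using (hf.1.mul hh.1).sub (hf.2.mul hh.2),
    by simpa using (hf.1.mul hh.2).add (hf.2.mul hh.1)⟩

theorem pow (hf : IsPolyC f) (n : ℕ) : IsPolyC (fun x => f x ^ n) := by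
  induction n with
  | zero => simpa using const 1
  | succ n ih => simpa only [pow_succ] using ih.mul hf

end IsPolyC

namespace IsPolyVec

variable {f h k l : Config → FourVector}

theorem add (hf : IsPolyVec f) (hh : IsPolyVec h) : IsPolyVec (fun x => f x + h x) :=
  fun μ => (hf μ).add (hh μ)

theorem sub (hf : IsPolyVec f) (hh : IsPolyVec h) : IsPolyVec (fun x => f x - h x) :=
  fun μ => (hf μ).sub (hh μ)

theorem mink (hf : IsPolyVec f) (hh : IsPolyVec h) :
    IsPoly (fun x => Chirality.mink (f x) (h x)) :=
  ((((hf 0).mul (hh 0)).sub ((hf 1).mul (hh 1))).sub ((hf 2).mul (hh 2))).sub ((hf 3).mul (hh 3))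

theorem bracket (s : ℝ) (hf : IsPolyVec f) (hh : IsPolyVec h) (hk : IsPolyVec k)
    (hl : IsPolyVec l) : IsPoly (fun x => Chirality.bracket s (f x) (h x) (k x) (l x)) := by
  have minor {f h : Config → FourVector} (hf : IsPolyVec f) (hh : IsPolyVec h) (μ ν : Fin 4) :
      IsPoly (fun x => f x μ * h x ν - f x ν * h x μ) :=
    ((hf μ).mul (hh ν)).sub ((hf ν).mul (hh μ))
  simp only [bracket_eq]
  have m := minor hf hh
  have n := minor hk hl
  exact (IsPoly.const s).mul
    ((((((m 0 1).mul (n 2 3)).sub ((m 0 2).mul (n 1 3))).add ((m 0 3).mul (n 1 2))).add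
      ((m 1 2).mul (n 0 3))).sub ((m 1 3).mul (n 0 2)) |>.add ((m 2 3).mul (n 0 1)))

end IsPolyVec

/-! ### Polynomiality of the ingredients and of the variables -/

section

variable {s : ℝ} {y : Config → Config} {f h : Config → FourVector}

/-- Each component map of `y` is one of the momenta. -/
def IsRelabelling (y : Config → Config) : Prop := ∀ i, ∃ j, ∀ x : Config, y x i = x j

theorem IsRelabelling.isPolyVec (hy : IsRelabelling y) (i : Fin 2 ⊕ Fin 3) :
    IsPolyVec (fun x => y x i) := by
  obtain ⟨j, hj⟩ := hy i
  exact fun μ => ⟨MvPolynomial.X (j, μ), fun x => by simp [hj]⟩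

theorem isRelabelling_permAct (τ : Equiv.Perm (Fin 2)) (σ : Equiv.Perm (Fin 3)) :
    IsRelabelling (permAct τ σ) := fun i => ⟨Equiv.sumCongr τ σ i, fun _ => rfl⟩

theorem isRelabelling_id : IsRelabelling (fun x => x) := fun i => ⟨i, fun _ => rfl⟩

/-- A general relabelling `y` is needed because the sums `V6` and `V7` evaluate the ingredients at
permuted configurations. -/
theorem isPoly_eps (hy : IsRelabelling y) (hf : IsPolyVec f) (hh : IsPolyVec h) :
    IsPoly (fun x => eps s (y x) (f x) (h x)) :=
  hf.bracket s hh (hy.isPolyVec _) (hy.isPolyVec _)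

theorem isPoly_g (hy : IsRelabelling y) (hf : IsPolyVec f) (hh : IsPolyVec h) :
    IsPoly (fun x => g (y x) (f x) (h x)) := by
  have hP := (hy.isPolyVec (Sum.inl 0)).add (hy.isPolyVec (Sum.inl 1))
  simp only [g_eq]
  exact ((hf.mink hh).mul (hP.mink hP)).sub ((hf.mink hP).mul (hP.mink hh))

theorem isPoly_P1 (hy : IsRelabelling y) : IsPoly (fun x => P1 s (y x)) := by
  have v := hy.isPolyVec
  have e {i j} := isPoly_eps (s := s) hy (v i) (v j)
  exact (e.add e).add e

theorem isPoly_P2 (hy : IsRelabelling y) : IsPoly (fun x => P2 s (y x)) := by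
  have v := hy.isPolyVec
  have e {i j} := isPoly_eps (s := s) hy (v i) (v j)
  exact (e.mul e).mul e

theorem isPoly_P3 (hy : IsRelabelling y) : IsPoly (fun x => P3 s (y x)) := by
  have v := hy.isPolyVec
  have e {i j} := isPoly_eps (s := s) hy (v i) (v j)
  exact ((e.sub e).mul (e.sub e)).mul (e.sub e)

theorem isPoly_F0 (hy : IsRelabelling y) : IsPoly (fun x => F0 (y x)) := by
  have v := hy.isPolyVec
  exact ((v _).mink (v _)).sub ((v _).mink (v _))

theorem isPoly_F1 (hy : IsRelabelling y) : IsPoly (fun x => F1 (y x)) := by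
  have v := hy.isPolyVec
  exact isPoly_g hy (((v _).add (v _)).add (v _)) ((v _).sub (v _))

theorem isPoly_F2 (hy : IsRelabelling y) : IsPoly (fun x => F2 (y x)) := by
  have v := hy.isPolyVec
  have e {i} := isPoly_g hy (v i) ((v (Sum.inl 0)).sub (v (Sum.inl 1)))
  exact (e.mul e).mul e

theorem isPoly_F3 (hy : IsRelabelling y) : IsPoly (fun x => F3 (y x)) := by
  have v := hy.isPolyVec
  have e {i j} := isPoly_g hy ((v i).sub (v j)) ((v (Sum.inl 0)).sub (v (Sum.inl 1)))
  exact (e.mul e).mul e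

theorem isPolyC_PC (w : ℝ) : IsPolyC (fun x => PC s x w) :=
  ((isPoly_P1 isRelabelling_id).ofReal.pow 3).add
    ((IsPolyC.const (Complex.I * w)).mul (isPoly_P2 isRelabelling_id).ofReal)

theorem isPolyC_FC (w : ℝ) : IsPolyC (fun x => FC x w) :=
  (isPoly_F1 isRelabelling_id).ofReal.add
    ((IsPolyC.const (Complex.I * w)).mul (isPoly_F2 isRelabelling_id).ofReal)

theorem isPolyC_dC (w : ℝ) (hf : IsPolyVec f) (hh : IsPolyVec h) :
    IsPolyC (fun x => dC x w (f x) (h x)) := by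
  have v := isRelabelling_id.isPolyVec
  have e {f h} := isPoly_g (f := f) (h := h) isRelabelling_id
  have w3 := ((v (Sum.inr 0)).add (v (Sum.inr 1))).add (v (Sum.inr 2))
  exact ((e hf hf).sub (e hh hh)).ofReal.add
    ((IsPolyC.const (Complex.I * w)).mul ((e hf w3).sub (e hh w3)).ofReal)

theorem isPolyC_df3 (hf : IsPolyVec f) (hh : IsPolyVec h) :
    IsPolyC (fun x => (df3 (f x) (h x) : ℂ)) :=
  ((hf.mink hf).sub (hh.mink hh)).ofReal

theorem isPolyC_df4 (hf : IsPolyVec f) (hh : IsPolyVec h) :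
    IsPolyC (fun x => (df4 x (f x) (h x) : ℂ)) := by
  have v := isRelabelling_id.isPolyVec
  have n := (v (Sum.inl 0)).sub (v (Sum.inl 1))
  exact ((isPoly_g isRelabelling_id hf n).sub (isPoly_g isRelabelling_id hh n)).ofReal

theorem isPolyC_U {F H : Config → FourVector → FourVector → ℂ}
    (hF : ∀ i j, IsPolyC (fun x => F x (x i) (x j)))
    (hH : ∀ i j, IsPolyC (fun x => H x (x i) (x j))) : IsPolyC (fun x => U x (F x) (H x)) :=
  ((((hF _ _).mul (hF _ _)).mul (hH _ _)).add (((hF _ _).mul (hH _ _)).mul (hF _ _))).add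
    (((hH _ _).mul (hF _ _)).mul (hF _ _))

theorem isPoly_V (s : ℝ) (u : Fin 15 → ℝ) (i : Fin 19) : IsPoly (V s u i) := by
  have r := isRelabelling_id
  have v := r.isPolyVec
  have D (w : ℝ) (i j) := isPolyC_dC w (v i) (v j)
  have E (i j) := isPolyC_df3 (v i) (v j)
  have h0 := (isPoly_F0 r).ofReal
  have T (w : ℝ) (i j) := ((E i j).mul h0).add
    ((IsPolyC.const (Complex.I * w)).mul (isPolyC_df4 (v i) (v j)))
  refine forall_V s u ((isPoly_P1 r).mul (isPoly_F3 r)) ((isPoly_P2 r).mul (isPoly_F3 r))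
    ((isPoly_P3 r).mul (isPoly_F0 r)) ((isPoly_P3 r).mul (isPoly_F1 r))
    ((isPoly_P3 r).mul (isPoly_F2 r)) ?_ ?_
    ((isPolyC_PC _).mul (isPolyC_U (D _) fun i j => (D _ i j).mul (isPolyC_FC _)))
    ((isPolyC_PC _).mul (isPolyC_U (D _) fun i j => (D _ i j).mul h0))
    ((isPolyC_PC _).mul (isPolyC_U (D _) fun i j => (E i j).mul (isPolyC_FC _)))
    ((isPolyC_PC _).mul (isPolyC_U (D _) fun i j => T _ i j))
    ((isPolyC_PC _).mul (isPolyC_U (fun i j => E i j) fun i j => (E i j).mul (isPolyC_FC _)))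
    ((isPolyC_PC _).mul (isPolyC_U (fun i j => E i j) fun i j => T _ i j)) i
  · refine IsPoly.sum _ fun σ => ?_
    have r := isRelabelling_permAct 1 σ
    have v := r.isPolyVec
    have e {i j} := (isPoly_eps (s := s) r (v i) (v j)).pow 2
    have k {i} := isPoly_g r (v i) ((v (Sum.inl 0)).sub (v (Sum.inl 1)))
    exact ((((isPoly_P3 r).mul (isPoly_F3 r)).mul k).mul k).mul (e.sub e)
  · refine IsPoly.sum _ fun σ => ?_
    have r := isRelabelling_permAct 1 σ
    have v := r.isPolyVec
    have k {i} := isPoly_g r (v i) ((v (Sum.inl 0)).sub (v (Sum.inl 1)))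
    exact ((((isPoly_P3 r).mul (isPoly_F3 r)).mul k).mul k).mul
      (((v _).mink (v _)).sub ((v _).mink (v _)))

end

/-! ### Isometries and reflections -/

theorem mink_eq_dotProduct (y z : FourVector) : mink y z = y ⬝ᵥ metric.mulVec z := by
  simp [mink, metric, Matrix.mulVec_diagonal, dotProduct, Fin.sum_univ_four]
  ring

theorem mink_mulVec_mulVec (L : Matrix (Fin 4) (Fin 4) ℝ) (y z : FourVector) :
    mink (L.mulVec y) (L.mulVec z) = y ⬝ᵥ (L.transpose * metric * L).mulVec z := by
  rw [mink_eq_dotProduct, ← Matrix.mulVec_mulVec, ← Matrix.mulVec_mulVec,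
    Matrix.dotProduct_mulVec y, Matrix.vecMul_transpose]

theorem isometry_iff (L : Matrix (Fin 4) (Fin 4) ℝ) :
    (∀ y z, mink (L.mulVec y) (L.mulVec z) = mink y z) ↔
      L.transpose * metric * L = metric := by
  constructor
  · intro h
    ext i j
    have := h (Pi.single i 1) (Pi.single j 1)
    rw [mink_mulVec_mulVec, mink_eq_dotProduct] at this
    simpa [Matrix.mulVec_single_one] using this
  · intro h y z
    rw [mink_mulVec_mulVec, h, mink_eq_dotProduct]

theorem parityVec_eq (y : FourVector) : parityVec y = metric.mulVec y := by
  ext i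
  fin_cases i <;> simp [parityVec, metric, Matrix.mulVec_diagonal]

theorem parity_eq_lorentzAct (x : Config) : parity x = lorentzAct metric x :=
  funext fun _ => parityVec_eq _

theorem det_metric : metric.det = -1 := by
  simp [metric, Fin.prod_univ_four]

theorem mink_metric_mulVec (y z : FourVector) :
    mink (metric.mulVec y) (metric.mulVec z) = mink y z := by
  rw [← parityVec_eq, ← parityVec_eq]
  simp [mink, parityVec]

/-- The matrix of the reflection in the hyperplane orthogonal to `w`. -/
noncomputable def reflection (w : FourVector) : Matrix (Fin 4) (Fin 4) ℝ :=
  1 - Matrix.vecMulVec ((2 / mink w w) • w) (metric.mulVec w)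

theorem reflection_mulVec (w y : FourVector) :
    (reflection w).mulVec y = y - (2 * mink y w / mink w w) • w := by
  have : metric.mulVec w ⬝ᵥ y = mink y w := by rw [mink_eq_dotProduct, dotProduct_comm]
  rw [reflection, Matrix.sub_mulVec, Matrix.one_mulVec, Matrix.vecMulVec_mulVec, this]
  ext i
  simp
  ring

theorem mink_reflection {w : FourVector} (hw : mink w w ≠ 0) (y z : FourVector) :
    mink ((reflection w).mulVec y) ((reflection w).mulVec z) = mink y z := by
  simp only [reflection_mulVec, mink_sub_left, mink_sub_right, mink_smul_left, mink_smul_right,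
    mink_comm w z]
  field_simp
  ring

/-- The reflection is a rank-one perturbation of the identity, so its determinant is 1 minus a
pairing, here 1 - 2. -/
theorem det_reflection {w : FourVector} (hw : mink w w ≠ 0) : (reflection w).det = -1 := by
  have : metric.mulVec w ⬝ᵥ ((2 / mink w w) • w) = 2 := by
    rw [dotProduct_smul, dotProduct_comm, ← mink_eq_dotProduct, smul_eq_mul]
    field_simp
  rw [reflection, sub_eq_add_neg, ← Matrix.neg_vecMulVec, Matrix.vecMulVec_eq Unit,
    Matrix.det_one_add_replicateCol_mul_replicateRow, dotProduct_neg, this]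
  norm_num

/-- Both factors have determinant -1. Spacelikeness enters through the time-time entry 1 -
2(w⁰)²/w², which is then at least 1. -/
theorem reflection_mul_metric_mem {w : FourVector} (hw : mink w w < 0) :
    reflection w * metric ∈ SOPlus := by
  refine ⟨(isometry_iff _).1 fun y z => ?_, ?_, ?_⟩
  · rw [← Matrix.mulVec_mulVec, ← Matrix.mulVec_mulVec, mink_reflection hw.ne,
      mink_metric_mulVec]
  · rw [Matrix.det_mul, det_reflection hw.ne, det_metric]; norm_num
  · have : (reflection w * metric) 0 0 = 1 - 2 * w 0 ^ 2 / mink w w := by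
      simp [reflection, metric, Matrix.vecMulVec_apply, Matrix.mulVec_diagonal]
      ring
    rw [this]
    have : 2 * w 0 ^ 2 / mink w w ≤ 0 :=
      div_nonpos_of_nonneg_of_nonpos (by positivity) hw.le
    linarith

/-- A configuration mapped to a relabelling of itself by a spacelike reflection is not chiral. -/
theorem equivalent_parity_of_reflection {x : Config} {w : FourVector} (hw : mink w w < 0)
    (τ : Perm (Fin 2)) (σ : Perm (Fin 3))
    (h : ∀ k, x k = x (sumCongr τ σ k) - (2 * mink (x (sumCongr τ σ k)) w / mink w w) • w) :
    Equivalent x (parity x) := by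
  refine ⟨reflection w * metric, reflection_mul_metric_mem hw, τ, σ, funext fun k => ?_⟩
  have hmm : metric * metric = 1 := by
    ext i j
    fin_cases i <;> fin_cases j <;> simp [metric]
  change x k = (reflection w * metric).mulVec (parityVec (x (sumCongr τ σ k)))
  rw [parityVec_eq, Matrix.mulVec_mulVec, mul_assoc, hmm, mul_one, reflection_mulVec]
  exact h k

/-! ### Causal geometry -/

theorem forwardCone_nonneg {y : FourVector} (hy : y ∈ forwardCone) : 0 ≤ y 0 := by
  obtain ⟨m, -, h⟩ := hy
  rw [h]; positivity

theorem forwardCone_le {y : FourVector} (hy : y ∈ forwardCone) :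
    y 1 ^ 2 + y 2 ^ 2 + y 3 ^ 2 ≤ y 0 ^ 2 := by
  obtain ⟨m, -, h⟩ := hy
  rw [h, Real.sq_sqrt (by positivity)]
  nlinarith [sq_nonneg m]

theorem spatial_cauchy_schwarz (y z : FourVector) :
    (y 1 * z 1 + y 2 * z 2 + y 3 * z 3) ^ 2 ≤
      (y 1 ^ 2 + y 2 ^ 2 + y 3 ^ 2) * (z 1 ^ 2 + z 2 ^ 2 + z 3 ^ 2) := by
  linarith [sq_nonneg (y 1 * z 2 - y 2 * z 1), sq_nonneg (y 1 * z 3 - y 3 * z 1),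
    sq_nonneg (y 2 * z 3 - y 3 * z 2)]

theorem eq_zero_of_components {y : FourVector} (h0 : y 0 = 0)
    (h : y 1 ^ 2 + y 2 ^ 2 + y 3 ^ 2 ≤ 0) : y = 0 := by
  have h1 : y 1 = 0 := by nlinarith [sq_nonneg (y 1), sq_nonneg (y 2), sq_nonneg (y 3)]
  have h2 : y 2 = 0 := by nlinarith [sq_nonneg (y 1), sq_nonneg (y 2), sq_nonneg (y 3)]
  have h3 : y 3 = 0 := by nlinarith [sq_nonneg (y 1), sq_nonneg (y 2), sq_nonneg (y 3)]
  ext i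
  fin_cases i <;> assumption

theorem mink_nonneg {y z : FourVector} (hy : y ∈ forwardCone) (hz : z ∈ forwardCone) :
    0 ≤ mink y z := by
  have h : y 1 * z 1 + y 2 * z 2 + y 3 * z 3 ≤ y 0 * z 0 := by
    refine (abs_le_of_sq_le_sq' ?_ (mul_nonneg (forwardCone_nonneg hy) (forwardCone_nonneg hz))).2
    rw [mul_pow]
    exact (spatial_cauchy_schwarz y z).trans
      (mul_le_mul (forwardCone_le hy) (forwardCone_le hz) (by positivity) (by positivity))
  rw [mink]; linarith

theorem mink_self_eq (y : FourVector) :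
    mink y y = y 0 ^ 2 - (y 1 ^ 2 + y 2 ^ 2 + y 3 ^ 2) := by
  rw [mink]; ring

/-- Cauchy–Schwarz on the spatial parts, strict because P is timelike; y itself may be null. -/
theorem mink_pos {y P : FourVector} (hy : y ∈ forwardCone) (hy0 : y ≠ 0) (hP : 0 < mink P P)
    (hP0 : 0 ≤ P 0) : 0 < mink y P := by
  have hy1 := forwardCone_le hy
  have hpos : 0 < y 0 := by
    refine (forwardCone_nonneg hy).lt_of_ne fun h => hy0 (eq_zero_of_components h.symm ?_)
    rw [← h] at hy1; linarith
  rw [mink_self_eq] at hP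
  have h : y 1 * P 1 + y 2 * P 2 + y 3 * P 3 < y 0 * P 0 := by
    refine lt_of_abs_lt ((sq_lt_sq₀ (abs_nonneg _) (by positivity)).1 ?_)
    rw [sq_abs, mul_pow]
    refine (spatial_cauchy_schwarz y P).trans_lt ?_
    refine (mul_le_mul_of_nonneg_right hy1 (by positivity)).trans_lt ?_
    exact mul_lt_mul_of_pos_left (by linarith) (by positivity)
  rw [mink]; linarith

/-- If w² ≥ 0, orthogonality and Cauchy–Schwarz bound (w⁰)²(P⁰)² by (w⁰)² times the spatial square
of P, which is smaller than (P⁰)²; hence w⁰ = 0 and then w = 0. Applied with P = p + q, this makes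
every mirror normal spacelike. -/
theorem mink_self_neg {w P : FourVector} (hP : 0 < mink P P) (hw : w ≠ 0) (h : mink w P = 0) :
    mink w w < 0 := by
  by_contra! hn
  rw [mink_self_eq] at hn hP
  have h1 : w 0 * P 0 = w 1 * P 1 + w 2 * P 2 + w 3 * P 3 := by
    rw [mink] at h; linarith
  have h2 := spatial_cauchy_schwarz w P
  rw [← h1, mul_pow] at h2
  have h3 : w 0 ^ 2 * P 0 ^ 2 ≤ w 0 ^ 2 * (P 1 ^ 2 + P 2 ^ 2 + P 3 ^ 2) :=
    h2.trans (mul_le_mul_of_nonneg_right (by linarith) (by positivity))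
  have h4 : w 0 = 0 := by
    by_contra h0
    have := mul_lt_mul_of_pos_left (show P 1 ^ 2 + P 2 ^ 2 + P 3 ^ 2 < P 0 ^ 2 by linarith)
      (show 0 < w 0 ^ 2 by positivity)
    linarith
  exact hw (eq_zero_of_components h4 (by rw [h4] at hn; linarith))

theorem IsCollisionEvent.total_timelike {x : Config} (hx : IsCollisionEvent x) :
    0 < mink (vp x + vq x) (vp x + vq x) := by
  obtain ⟨hc, h⟩ := hx
  have h1 : 0 ≤ mink (vp x) (vp x) := mink_nonneg (hc _) (hc _)
  have h2 : 0 ≤ mink (vq x) (vq x) := mink_nonneg (hc _) (hc _)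
  have h3 : 0 ≤ mink (vp x) (vq x) := mink_nonneg (hc _) (hc _)
  have h4 : 0 < mink (vp x) (vq x) := by
    refine h3.lt_of_ne fun h0 => ?_
    have : mink (vp x) (vp x) * mink (vq x) (vq x) < mink (vp x) (vq x) ^ 2 := h
    rw [← h0] at this
    nlinarith [mul_nonneg h1 h2]
  rw [mink_add_left, mink_add_right, mink_add_right, mink_comm (vq x) (vp x)]
  linarith

theorem IsCollisionEvent.total_nonneg {x : Config} (hx : IsCollisionEvent x) :
    0 ≤ (vp x + vq x) 0 :=
  add_nonneg (forwardCone_nonneg (hx.1 _)) (forwardCone_nonneg (hx.1 _))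

theorem F0_eq (x : Config) : F0 x = mink (vp x - vq x) (vp x + vq x) := by
  simp only [F0, mink_sub_left, mink_add_right, mink_comm (vq x) (vp x)]; ring

theorem IsCollisionEvent.difference_spacelike {x : Config} (hx : IsCollisionEvent x)
    (h0 : F0 x = 0) : mink (vp x - vq x) (vp x - vq x) < 0 := by
  refine mink_self_neg hx.total_timelike (fun h => ?_) (F0_eq x ▸ h0)
  have h1 : vp x = vq x := sub_eq_zero.1 h
  have h2 : mink (vp x) (vp x) * mink (vq x) (vq x) < mink (vp x) (vq x) ^ 2 := hx.2
  rw [h1] at h2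
  linarith

/-- For F(0) = 0 the vector p - q is orthogonal to p + q, so the projection term of g drops out. -/
theorem g_difference {x : Config} (h0 : F0 x = 0) (y : FourVector) :
    g x y (vp x - vq x) = mink y (vp x - vq x) * mink (vp x + vq x) (vp x + vq x) := by
  rw [g_eq, mink_comm (vp x + vq x) (vp x - vq x), ← F0_eq, h0]; ring

/-! ### Configurations with a reflection symmetry -/

/-- The vector dual to the trilinear form `z ↦ [z, y, p, q]`. -/
def cross (y p q : FourVector) : FourVector :=
  ![y 1 * (p 2 * q 3 - p 3 * q 2) - y 2 * (p 1 * q 3 - p 3 * q 1) + y 3 * (p 1 * q 2 - p 2 * q 1),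
    y 0 * (p 2 * q 3 - p 3 * q 2) - y 2 * (p 0 * q 3 - p 3 * q 0) + y 3 * (p 0 * q 2 - p 2 * q 0),
    -(y 0 * (p 1 * q 3 - p 3 * q 1) - y 1 * (p 0 * q 3 - p 3 * q 0) + y 3 * (p 0 * q 1 - p 1 * q 0)),
    y 0 * (p 1 * q 2 - p 2 * q 1) - y 1 * (p 0 * q 2 - p 2 * q 0) + y 2 * (p 0 * q 1 - p 1 * q 0)]

theorem mink_cross (z y p q : FourVector) : mink z (cross y p q) = bracket 1 z y p q := by
  simp [mink, cross, bracket_eq]; ring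

/-- Crossing with basis vectors exhibits the 2 × 2 minors of p, q. The quantity (p·q)² - p²q² is the
sum of squares of the time-space minors minus that of the space-space ones, so they cannot all
vanish. -/
theorem exists_cross_ne_zero {p q : FourVector} (h : mink p p * mink q q < mink p q ^ 2) :
    ∃ y, cross y p q ≠ 0 := by
  by_contra! H
  have m (i j k : Fin 4) := congrFun (H (Pi.single i 1)) j
  have a01 := m 2 3 0
  have a02 := m 1 3 0
  have a03 := m 1 2 0
  have a12 := m 0 3 0
  have a13 := m 0 2 0
  have a23 := m 0 1 0
  simp [cross] at a01 a02 a03 a12 a13 a23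
  have : mink p q ^ 2 - mink p p * mink q q =
      (p 0 * q 1 - p 1 * q 0) ^ 2 + (p 0 * q 2 - p 2 * q 0) ^ 2 + (p 0 * q 3 - p 3 * q 0) ^ 2
      - (p 1 * q 2 - p 2 * q 1) ^ 2 - (p 1 * q 3 - p 3 * q 1) ^ 2
      - (p 2 * q 3 - p 3 * q 2) ^ 2 := by
    simp only [mink]; ring
  nlinarith [sq_nonneg (p 1 * q 2 - p 2 * q 1), sq_nonneg (p 1 * q 3 - p 3 * q 1),
    sq_nonneg (p 2 * q 3 - p 3 * q 2)]

section Symmetric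

variable {s : ℝ} {x : Config}

theorem eps_eq (s : ℝ) (x : Config) (y z : FourVector) :
    eps s x y z = s * mink y (cross z (vp x) (vq x)) := by
  rw [mink_cross, eps, bracket_eq, bracket_eq]; ring

theorem mink_cross_swap (y z p q : FourVector) : mink y (cross z p q) = -mink z (cross y p q) := by
  rw [mink_cross, mink_cross, bracket_eq, bracket_eq]; ring

/-- If all the brackets vanish, there is a reflection fixing all five momenta. -/
theorem equivalent_of_eps_eq_zero (hs : s ≠ 0) (hx : IsCollisionEvent x)
    (hab : eps s x (va x) (vb x) = 0) (hbc : eps s x (vb x) (vc x) = 0)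
    (hca : eps s x (vc x) (va x) = 0) : Equivalent x (parity x) := by
  set p := vp x with hp
  set q := vq x with hq
  have hp0 (y) : mink p (cross y p q) = 0 := by rw [mink_cross, bracket_eq]; ring
  have hq0 (y) : mink q (cross y p q) = 0 := by rw [mink_cross, bracket_eq]; ring
  -- A normal of the form `cross y p q` is automatically orthogonal to p and q, so only a, b, c need
  -- checking.
  have fixed {y : FourVector} (hy : cross y p q ≠ 0)
      (h : ∀ i, mink (x (Sum.inr i)) (cross y p q) = 0) : Equivalent x (parity x) := by
    refine equivalent_parity_of_reflection (w := cross y p q)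
      (mink_self_neg hx.total_timelike hy ?_) 1 1 fun k => ?_
    · rw [mink_comm, mink_add_left, hp0, hq0, add_zero]
    · have : mink (x k) (cross y p q) = 0 := by
        rcases k with k | k
        · fin_cases k
          · exact hp0 y
          · exact hq0 y
        · exact h k
      simp [this]
  simp only [eps_eq, mul_eq_zero, hs, false_or] at hab hbc hca
  have self (y) : mink y (cross y p q) = 0 := by rw [mink_cross, bracket_eq]; ring
  have hij (i j : Fin 3) : mink (x (Sum.inr i)) (cross (x (Sum.inr j)) p q) = 0 := by
    have hba := mink_cross_swap (vb x) (va x) p q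
    have hcb := mink_cross_swap (vc x) (vb x) p q
    have hac := mink_cross_swap (va x) (vc x) p q
    rw [hab, neg_zero] at hba
    rw [hbc, neg_zero] at hcb
    rw [hca, neg_zero] at hac
    fin_cases i <;> fin_cases j
    exacts [self _, hab, hac, hba, self _, hbc, hca, hcb, self _]
  -- Any non-zero cross product of one of a, b, c with p, q serves as normal. If all three vanish,
  -- antisymmetry of the bracket makes every `cross y p q` orthogonal to a, b, c.
  by_cases h : ∃ j, cross (x (Sum.inr j)) p q ≠ 0
  · obtain ⟨j, hj⟩ := h
    exact fixed hj fun i => hij i j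
  · push Not at h
    obtain ⟨y, hy⟩ := exists_cross_ne_zero hx.2
    refine fixed hy fun i => ?_
    rw [mink_cross_swap, h i]
    simp [mink]

/-- The reflection in `y - z` exchanges `y` and `z` if `y² = z²`. -/
theorem eq_reflection_sub {y z : FourVector} (h : mink y y = mink z z)
    (hn : mink (y - z) (y - z) ≠ 0) :
    y = z - (2 * mink z (y - z) / mink (y - z) (y - z)) • (y - z) := by
  have : 2 * mink z (y - z) = -mink (y - z) (y - z) := by
    simp only [mink_sub_left, mink_sub_right, mink_comm z y, h]; ring
  rw [this, neg_div, div_self hn]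
  simp

theorem eq_reflection_sub' {y z : FourVector} (h : mink y y = mink z z)
    (hn : mink (y - z) (y - z) ≠ 0) :
    z = y - (2 * mink y (y - z) / mink (y - z) (y - z)) • (y - z) := by
  have : 2 * mink y (y - z) = mink (y - z) (y - z) := by
    simp only [mink_sub_left, mink_sub_right, mink_comm z y, h]; ring
  rw [this, div_self hn]
  simp

theorem reflection_difference (h0 : F0 x = 0)
    (hn : mink (vp x - vq x) (vp x - vq x) ≠ 0) (k : Fin 2) :
    x (Sum.inl k) = x (Sum.inl (swap 0 1 k)) -
      (2 * mink (x (Sum.inl (swap 0 1 k))) (vp x - vq x) / mink (vp x - vq x) (vp x - vq x)) •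
        (vp x - vq x) := by
  have hpq : mink (vp x) (vp x) = mink (vq x) (vq x) := sub_eq_zero.1 h0
  fin_cases k
  · exact eq_reflection_sub hpq hn
  · exact eq_reflection_sub' hpq hn

/-- If `p² = q²` and `a, b, c` are orthogonal to `p - q`, then the reflection in `p - q`
exchanges `p, q` and fixes `a, b, c`. -/
theorem equivalent_of_orthogonal (hx : IsCollisionEvent x) (h0 : F0 x = 0)
    (h : ∀ i, g x (x (Sum.inr i)) (vp x - vq x) = 0) : Equivalent x (parity x) := by
  have hn := hx.difference_spacelike h0
  have hT := hx.total_timelike.ne'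
  refine equivalent_parity_of_reflection hn (swap 0 1) 1 ?_
  rintro (k | k)
  · exact reflection_difference h0 hn.ne k
  · have := h k
    rw [g_difference h0, mul_eq_zero, or_iff_left hT] at this
    simp only [sumCongr_apply, Sum.map_inr, Perm.one_apply, this]
    simp

/-- Cramer's rule: the linear relation among five vectors of a four-dimensional space. -/
theorem bracket_cramer (s : ℝ) (v y r p q : FourVector) :
    bracket s y r p q • v = bracket s v r p q • y + bracket s y v p q • r
      + bracket s y r v q • p + bracket s y r p v • q := by
  ext μ
  simp only [bracket_eq, Pi.add_apply, Pi.smul_apply, smul_eq_mul]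
  fin_cases μ <;> simp <;> ring

/-- If `p² = q²`, `y² = z²`, the third momentum `r` is orthogonal to `p - q`, and `y - z` is
parallel to `p - q`, then the reflection in `p - q` exchanges `p, q` and exchanges `y, z`. -/
theorem equivalent_of_exchange (hx : IsCollisionEvent x) {i j k : Fin 3}
    (hk : ∀ l, l = i ∨ l = j ∨ l = k) (hik : i ≠ k) (hjk : j ≠ k)
    (h0 : F0 x = 0)
    (hyz : g x (x (Sum.inr i)) (vp x - vq x) + g x (x (Sum.inr j)) (vp x - vq x) = 0)
    (hr : g x (x (Sum.inr k)) (vp x - vq x) = 0)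
    (e1 : eps s x (x (Sum.inr i)) (x (Sum.inr j)) = 0)
    (e2 : eps s x (x (Sum.inr i)) (x (Sum.inr k)) = eps s x (x (Sum.inr j)) (x (Sum.inr k)))
    (e3 : eps s x (x (Sum.inr i)) (x (Sum.inr k)) ≠ 0)
    (hm : mink (x (Sum.inr i)) (x (Sum.inr i)) = mink (x (Sum.inr j)) (x (Sum.inr j))) :
    Equivalent x (parity x) := by
  have hn := hx.difference_spacelike h0
  have hT := hx.total_timelike
  have hyc := hx.1 (Sum.inr i)
  have hzc := hx.1 (Sum.inr j)
  rw [g_difference h0, g_difference h0, ← add_mul, mul_eq_zero, or_iff_left hT.ne'] at hyz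
  rw [g_difference h0, mul_eq_zero, or_iff_left hT.ne'] at hr
  have key : ∃ t : ℝ, x (Sum.inr i) - x (Sum.inr j) = t • (vp x - vq x) := by
    generalize x (Sum.inr i) = y at *
    generalize x (Sum.inr j) = z at *
    generalize x (Sum.inr k) = r at *
    have hy0 : y ≠ 0 := by
      rintro rfl
      exact e3 (by simp [eps, bracket_eq])
    have c := bracket_cramer s (y - z) y r (vp x) (vq x)
    have c1 : bracket s (y - z) r (vp x) (vq x) = 0 := by
      have := eps_sub_left s x y z r
      rw [e2, sub_self] at this
      exact this
    have c2 : bracket s y (y - z) (vp x) (vq x) = 0 := by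
      have : eps s x y (y - z) = 0 := by
        rw [eps_swap, eps_sub_left, eps_self, eps_swap, e1]; simp
      exact this
    -- The bracket conditions remove the y and r components, leaving d(y - z) = Ap + Bq with d ≠ 0.
    -- It remains to see that A + B = 0.
    rw [c1, c2, zero_smul, zero_smul, zero_add, zero_add] at c
    set A := bracket s y r (y - z) (vq x)
    set B := bracket s y r (vp x) (y - z)
    set d := bracket s y r (vp x) (vq x) with hd
    have hd0 : d ≠ 0 := e3
    have hpY : mink (vp x) (y + z) = mink (vq x) (y + z) := by
      rw [mink_add_right, mink_add_right]
      simp only [mink_sub_right] at hyz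
      rw [mink_comm (vp x) y, mink_comm (vp x) z, mink_comm (vq x) y, mink_comm (vq x) z]
      linarith
    have hPY : 0 < mink (vp x) (y + z) := by
      have h1 := mink_pos hyc hy0 hT hx.total_nonneg
      have h2 : 0 ≤ mink z (vp x + vq x) := by
        rw [mink_add_right]
        exact add_nonneg (mink_nonneg hzc (hx.1 _)) (mink_nonneg hzc (hx.1 _))
      have h3 : mink y (vp x + vq x) + mink z (vp x + vq x)
          = mink (vp x) (y + z) + mink (vq x) (y + z) := by
        rw [← mink_add_left, mink_comm, mink_add_left]
      linarith
    -- Pair the relation with y + z: the left side vanishes because y² = z², while p and q have the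
    -- same positive product with y + z.
    have hAB : A + B = 0 := by
      have h1 := congrArg (fun v => mink v (y + z)) c
      simp only [mink_smul_left, mink_add_left, ← hpY] at h1
      have h2 : mink (y - z) (y + z) = 0 := by
        simp only [mink_sub_left, mink_add_right, mink_comm z y, hm]; ring
      rw [h2, mul_zero, ← add_mul] at h1
      exact (mul_eq_zero.1 h1.symm).resolve_right hPY.ne'
    refine ⟨A / d, ?_⟩
    have hB : B = -A := by linarith
    rw [hB] at c
    rw [div_eq_inv_mul, mul_smul, eq_inv_smul_iff₀ hd0, c]
    module
  obtain ⟨t, ht⟩ := key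
  -- The products of y and z with p - q are opposite, so pairing y - z = t(p - q) with p - q
  -- determines both.
  have hy : 2 * mink (x (Sum.inr i)) (vp x - vq x) =
      t * mink (vp x - vq x) (vp x - vq x) := by
    rw [← mink_smul_left t, ← ht, mink_sub_left]; linarith
  have hz : 2 * mink (x (Sum.inr j)) (vp x - vq x) =
      -t * mink (vp x - vq x) (vp x - vq x) := by
    linarith
  refine equivalent_parity_of_reflection hn (swap 0 1) (swap i j) ?_
  rintro (l | l)
  · exact reflection_difference h0 hn.ne l
  · simp only [sumCongr_apply, Sum.map_inr]
    rcases hk l with rfl | rfl | rfl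
    · rw [swap_apply_left, hz, mul_div_assoc, div_self hn.ne, mul_one, neg_smul, ← ht]
      abel
    · rw [swap_apply_right, hy, mul_div_assoc, div_self hn.ne, mul_one, ← ht]
      abel
    · rw [swap_apply_of_ne_of_ne hik.symm hjk.symm, hr]
      simp

/-- If the differences of all four kinds vanish for two distinct momenta `y, z`, then the
reflection in `y - z` exchanges them and fixes the other three momenta. -/
theorem equivalent_of_differences (hx : IsCollisionEvent x) {i j k : Fin 3}
    (hk : ∀ l, l = i ∨ l = j ∨ l = k) (hik : i ≠ k) (hjk : j ≠ k)
    (hsum : va x + vb x + vc x = x (Sum.inr i) + x (Sum.inr j) + x (Sum.inr k))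
    (hne : x (Sum.inr i) ≠ x (Sum.inr j))
    (h1 : df1 x (x (Sum.inr i)) (x (Sum.inr j)) = 0)
    (h2 : df2 x (x (Sum.inr i)) (x (Sum.inr j)) = 0)
    (h3 : df3 (x (Sum.inr i)) (x (Sum.inr j)) = 0)
    (h4 : df4 x (x (Sum.inr i)) (x (Sum.inr j)) = 0) :
    Equivalent x (parity x) := by
  have hT := hx.total_timelike
  have hyc := hx.1 (Sum.inr i)
  have hzc := hx.1 (Sum.inr j)
  have hm : mink (x (Sum.inr i)) (x (Sum.inr i)) = mink (x (Sum.inr j)) (x (Sum.inr j)) :=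
    sub_eq_zero.1 h3
  rw [df2, hsum] at h2
  have hw0 : x (Sum.inr i) - x (Sum.inr j) ≠ 0 := sub_ne_zero.2 hne
  have key : mink (x (Sum.inr i) - x (Sum.inr j)) (vp x + vq x) = 0 ∧
      mink (x (Sum.inr i) - x (Sum.inr j)) (vp x - vq x) = 0 ∧
      mink (x (Sum.inr i) - x (Sum.inr j)) (x (Sum.inr k)) = 0 := by
    generalize x (Sum.inr i) = y at *
    generalize x (Sum.inr j) = z at *
    generalize x (Sum.inr k) = r at *
    have hnonneg {v} (hv : v ∈ forwardCone) : 0 ≤ mink v (vp x + vq x) := by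
      rw [mink_add_right]
      exact add_nonneg (mink_nonneg hv (hx.1 _)) (mink_nonneg hv (hx.1 _))
    -- Distinct y, z cannot both be zero, and a non-zero forward vector has positive product with P.
    have hpos : 0 < mink y (vp x + vq x) + mink z (vp x + vq x) := by
      rcases eq_or_ne y 0 with hy | hy
      · have hz : z ≠ 0 := fun hz => hne (hy.trans hz.symm)
        linarith [hnonneg hyc, mink_pos hzc hz hT hx.total_nonneg]
      · linarith [hnonneg hzc, mink_pos hyc hy hT hx.total_nonneg]
    -- For equal masses the first difference is (z·P)² - (y·P)², and positivity excludes opposite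
    -- roots. The remaining g-differences then become plain products with y - z, up to the factor
    -- P².
    have hP : mink (y - z) (vp x + vq x) = 0 := by
      simp only [df1, g_eq, hm, mink_comm (vp x + vq x) y, mink_comm (vp x + vq x) z] at h1
      rw [mink_sub_left]
      refine (mul_eq_zero.1 (?_ : _ * (mink y (vp x + vq x) + mink z (vp x + vq x)) = 0)).resolve_right
        hpos.ne'
      linear_combination -h1
    have hg (v) : g x (y - z) v = mink (y - z) v * mink (vp x + vq x) (vp x + vq x) := by
      rw [g_eq, hP]; ring
    refine ⟨hP, ?_, ?_⟩
    · rw [df4, ← g_sub_left, hg] at h4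
      exact (mul_eq_zero.1 h4).resolve_right hT.ne'
    -- Since y - z is orthogonal to y + z, orthogonality to a + b + c reduces to orthogonality to
    -- the third momentum.
    · rw [← g_sub_left, hg] at h2
      have := (mul_eq_zero.1 h2).resolve_right hT.ne'
      rw [mink_add_right, mink_add_right] at this
      simp only [mink_sub_left, mink_comm z y] at this ⊢
      linarith
  obtain ⟨hP, hn, hr⟩ := key
  have hneg := mink_self_neg hT hw0 hP
  refine equivalent_parity_of_reflection hneg 1 (swap i j) ?_
  rw [mink_add_right] at hP
  rw [mink_sub_right] at hn
  rintro (l | l)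
  · have : mink (x (Sum.inl l)) (x (Sum.inr i) - x (Sum.inr j)) = 0 := by
      rw [mink_comm]
      fin_cases l
      · change mink _ (vp x) = 0; linarith
      · change mink _ (vq x) = 0; linarith
    simp only [sumCongr_apply, Sum.map_inl, Perm.one_apply, this]
    simp
  · simp only [sumCongr_apply, Sum.map_inr]
    rcases hk l with rfl | rfl | rfl
    · rw [swap_apply_left]
      exact eq_reflection_sub hm hneg.ne
    · rw [swap_apply_right]
      exact eq_reflection_sub' hm hneg.ne
    · rw [swap_apply_of_ne_of_ne hik.symm hjk.symm, mink_comm, hr]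
      simp

end Symmetric

/-! ### Vanishing of the event variables -/

/-- The six terms of `V₆` and of `V₇` combine pairwise. -/
theorem V6_eq (s : ℝ) (x : Config) {n : FourVector} (hn : n = vp x - vq x) :
    V6 s x = 2 * (P3 s x * F3 x) *
      (g x (va x) n * g x (vc x) n * (eps s x (va x) (vb x) ^ 2 - eps s x (vb x) (vc x) ^ 2)
      + g x (vb x) n * g x (va x) n * (eps s x (vb x) (vc x) ^ 2 - eps s x (vc x) (va x) ^ 2)
      + g x (vc x) n * g x (vb x) n *
        (eps s x (vc x) (va x) ^ 2 - eps s x (va x) (vb x) ^ 2)) := by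
  subst hn
  have e1 := eps_swap s x (vb x) (va x)
  have e2 := eps_swap s x (vc x) (vb x)
  have e3 := eps_swap s x (va x) (vc x)
  rw [V6, sum_perm_three]
  simp only [P3_permAct, F3_permAct, vp_sub_vq_permAct, g_permAct, g_smul_right, eps_permAct,
    sgn_one]
  simp only [va_permAct, vb_permAct, vc_permAct, sgn, Perm.sign_mul, Perm.sign_swap',
    Perm.mul_apply, Perm.one_apply, swap_apply_def]
  simp
  have ha : x (Sum.inr 0) = va x := rfl
  have hb : x (Sum.inr 1) = vb x := rfl
  have hc : x (Sum.inr 2) = vc x := rfl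
  simp only [ha, hb, hc, e1, e2, e3]
  ring

theorem V7_eq (s : ℝ) (x : Config) {n : FourVector} (hn : n = vp x - vq x) :
    V7 s x = 2 * (P3 s x * F3 x) *
      (g x (va x) n * g x (vc x) n * (mink (va x) (va x) - mink (vc x) (vc x))
      + g x (vb x) n * g x (va x) n * (mink (vb x) (vb x) - mink (va x) (va x))
      + g x (vc x) n * g x (vb x) n * (mink (vc x) (vc x) - mink (vb x) (vb x))) := by
  subst hn
  rw [V7, sum_perm_three]
  simp only [P3_permAct, F3_permAct, vp_sub_vq_permAct, g_permAct, g_smul_right, sgn_one]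
  simp only [va_permAct, vc_permAct, sgn, Perm.sign_mul, Perm.sign_swap',
    Perm.mul_apply, Perm.one_apply, swap_apply_def]
  simp
  have ha : x (Sum.inr 0) = va x := rfl
  have hb : x (Sum.inr 1) = vb x := rfl
  have hc : x (Sum.inr 2) = vc x := rfl
  simp only [ha, hb, hc]
  ring

/-- Three numbers with vanishing sum, product and product of differences are zero. -/
theorem eq_zero_of_symmetric_values {e₁ e₂ e₃ : ℝ} (h1 : e₁ + e₂ + e₃ = 0) (h2 : e₁ * e₂ * e₃ = 0)
    (h3 : (e₁ - e₂) * (e₂ - e₃) * (e₃ - e₁) = 0) : e₁ = 0 ∧ e₂ = 0 ∧ e₃ = 0 := by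
  have h : e₃ = -e₁ - e₂ := by linarith
  subst h
  rcases mul_eq_zero.1 h2 with h | h
  · rcases mul_eq_zero.1 h with rfl | rfl <;>
    · ring_nf at h3
      simp_all
  · obtain rfl : e₂ = -e₁ := by linarith
    ring_nf at h3
    simp_all

/-- Here z, e, m stand for the values of g against p - q, the brackets, and the squared masses. With
z₃ = 0 and z₂ = -z₁ ≠ 0, only the z₂z₁ terms of the two sums survive, giving e₂² = e₃² and m₁ = m₂.
-/
theorem exchange_values {z₁ z₂ z₃ e₁ e₂ e₃ m₁ m₂ m₃ : ℝ} (hF1 : z₁ + z₂ + z₃ = 0) (hz : z₃ = 0)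
    (hF3 : (z₁ - z₂) * (z₂ - z₃) * (z₃ - z₁) ≠ 0)
    (hP1 : e₁ + e₂ + e₃ = 0) (hP2 : e₁ * e₂ * e₃ = 0)
    (h6 : z₁ * z₃ * (e₁ ^ 2 - e₂ ^ 2) + z₂ * z₁ * (e₂ ^ 2 - e₃ ^ 2)
      + z₃ * z₂ * (e₃ ^ 2 - e₁ ^ 2) = 0)
    (h7 : z₁ * z₃ * (m₁ - m₃) + z₂ * z₁ * (m₂ - m₁) + z₃ * z₂ * (m₃ - m₂) = 0) :
    e₁ = 0 ∧ e₃ = -e₂ ∧ m₁ = m₂ := by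
  subst hz
  obtain rfl : z₂ = -z₁ := by linarith
  have hz1 : z₁ ≠ 0 := by
    rintro rfl
    simp at hF3
  have h7' : m₂ - m₁ = 0 := by
    have : z₁ ^ 2 * (m₂ - m₁) = 0 := by linarith
    exact (mul_eq_zero.1 this).resolve_left (by positivity)
  have h6' : (e₂ - e₃) * (e₂ + e₃) = 0 := by
    have : z₁ ^ 2 * ((e₂ - e₃) * (e₂ + e₃)) = 0 := by linarith
    exact (mul_eq_zero.1 this).resolve_left (by positivity)
  rcases mul_eq_zero.1 h6' with h | h
  -- With e₂ = e₃, vanishing sum and product force all brackets to be zero, so the conclusion still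
  -- holds.
  · obtain rfl : e₂ = e₃ := by linarith
    obtain rfl : e₁ = -2 * e₂ := by linarith
    have : e₂ = 0 := by
      have : e₂ ^ 3 = 0 := by linarith
      simpa using this
    subst this
    simp; linarith
  · exact ⟨by linarith, by linarith, by linarith⟩

/-- `U[f, h]` as a function of the values of `f` and `h` at `(a, b), (b, c), (c, a)`. -/
def cyclicSum (f₁ f₂ f₃ h₁ h₂ h₃ : ℂ) : ℂ := f₁ * f₂ * h₃ + f₁ * h₂ * f₃ + h₁ * f₂ * f₃

theorem cyclicSum_rotate (f₁ f₂ f₃ h₁ h₂ h₃ : ℂ) :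
    cyclicSum f₂ f₃ f₁ h₂ h₃ h₁ = cyclicSum f₁ f₂ f₃ h₁ h₂ h₃ := by
  simp only [cyclicSum]; ring

/-- Non-vanishing of the constants u enters the completeness argument only through this separation
of real and imaginary parts. -/
theorem add_I_mul_eq_zero {α β w : ℝ} (hw : w ≠ 0)
    (h : (α : ℂ) + Complex.I * w * β = 0) : α = 0 ∧ β = 0 := by
  have h1 := congrArg Complex.re h
  have h2 := congrArg Complex.im h
  simp at h1 h2
  exact ⟨h1, h2.resolve_left hw⟩

/-- The case in which the first two kinds of differences vanish for the pair `i`. -/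
theorem difference_values_aux {α β γ ζ : Fin 3 → ℝ} {i j k : Fin 3} {F₀ : ℝ} {f₃ f₅ : ℂ}
    {w₃ w₄ w₄' w₆ : ℝ} (hw₃ : w₃ ≠ 0) (hw₄ : w₄ ≠ 0) (hw₄' : w₄' ≠ 0) (hw₆ : w₆ ≠ 0)
    (hα : α i + α j + α k = 0) (hβ : β i + β j + β k = 0) (hγ : γ i + γ j + γ k = 0)
    (hζ : ζ i * ζ j * ζ k = 0)
    (h₃ : cyclicSum (α i + Complex.I * w₃ * β i) (α j + Complex.I * w₃ * β j)
      (α k + Complex.I * w₃ * β k) (γ i * f₃) (γ j * f₃) (γ k * f₃) = 0)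
    (h₄ : cyclicSum (α i + Complex.I * w₄ * β i) (α j + Complex.I * w₄ * β j)
      (α k + Complex.I * w₄ * β k) (γ i * F₀ + Complex.I * w₄' * ζ i)
      (γ j * F₀ + Complex.I * w₄' * ζ j) (γ k * F₀ + Complex.I * w₄' * ζ k) = 0)
    (h₅ : cyclicSum (γ i) (γ j) (γ k) (γ i * f₅) (γ j * f₅) (γ k * f₅) = 0)
    (h₆ : cyclicSum (γ i) (γ j) (γ k) (γ i * F₀ + Complex.I * w₆ * ζ i)
      (γ j * F₀ + Complex.I * w₆ * ζ j) (γ k * F₀ + Complex.I * w₆ * ζ k) = 0)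
    (hF : F₀ ≠ 0 ∨ f₃ ≠ 0 ∧ f₅ ≠ 0) (hαi : α i = 0) (hβi : β i = 0) :
    ∃ l, (l = i ∨ l = j ∨ l = k) ∧ α l = 0 ∧ β l = 0 ∧ γ l = 0 ∧ ζ l = 0 := by
  have hαk : α k = -α j := by linarith
  have hβk : β k = -β j := by linarith
  simp only [cyclicSum, hαi, hβi, hαk, hβk] at h₃ h₄
  -- If this holds, the first two differences vanish for every pair, so a pair with γ = ζ = 0
  -- suffices, and `h₅`, `h₆` must supply it.
  by_cases hj : α j = 0 ∧ β j = 0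
  · have h6' : ((3 * (γ i * γ j * γ k) * F₀ : ℝ) : ℂ) + Complex.I * w₆ *
        ((γ i * γ j * ζ k + γ i * ζ j * γ k + ζ i * γ j * γ k : ℝ) : ℂ) = 0 := by
      rw [← h₆, cyclicSum]; push_cast; ring
    obtain ⟨h61, h62⟩ := add_I_mul_eq_zero hw₆ h6'
    have hγ3 : γ i * γ j * γ k = 0 := by
      rcases hF with hF | ⟨-, hF⟩
      · have := (mul_eq_zero.1 h61).resolve_right hF
        linarith
      · have : (3 * f₅) * ((γ i * γ j * γ k : ℝ) : ℂ) = 0 := by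
          rw [← h₅, cyclicSum]; push_cast; ring
        exact_mod_cast (mul_eq_zero.1 this).resolve_left (by simpa using hF)
    have hαβ (l) (hl : l = i ∨ l = j ∨ l = k) : α l = 0 ∧ β l = 0 := by
      rcases hl with rfl | rfl | rfl
      exacts [⟨hαi, hβi⟩, hj, ⟨by rw [hαk, hj.1, neg_zero], by rw [hβk, hj.2, neg_zero]⟩]
    have all (h : γ i = 0 ∧ γ j = 0 ∧ γ k = 0) :
        ∃ l, (l = i ∨ l = j ∨ l = k) ∧ α l = 0 ∧ β l = 0 ∧ γ l = 0 ∧ ζ l = 0 := by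
      rcases mul_eq_zero.1 hζ with h' | h'
      · rcases mul_eq_zero.1 h' with h' | h'
        · exact ⟨i, .inl rfl, (hαβ i (.inl rfl)).1, (hαβ i (.inl rfl)).2, h.1, h'⟩
        · exact ⟨j, .inr (.inl rfl), hj.1, hj.2, h.2.1, h'⟩
      · exact ⟨k, .inr (.inr rfl), (hαβ k (.inr (.inr rfl))).1, (hαβ k (.inr (.inr rfl))).2,
          h.2.2, h'⟩
    -- Once γ vanishes at a pair, the imaginary part of `h₆` is a single product: either ζ vanishes
    -- there too, or a second γ does. In the latter case all γ vanish, and any pair with ζ = 0 will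
    -- do.
    have one {a b c : Fin 3} (ha : a = i ∨ a = j ∨ a = k) (h0 : γ a = 0)
        (hs : γ a + γ b + γ c = 0) (hU : γ b * γ c * ζ a = 0)
        (hall : γ a = 0 → γ b = 0 → γ c = 0 → γ i = 0 ∧ γ j = 0 ∧ γ k = 0) :
        ∃ l, (l = i ∨ l = j ∨ l = k) ∧ α l = 0 ∧ β l = 0 ∧ γ l = 0 ∧ ζ l = 0 := by
      rcases mul_eq_zero.1 hU with h | h
      · rcases mul_eq_zero.1 h with h | h
        · exact all (hall h0 h (by linarith))
        · exact all (hall h0 (by linarith) h)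
      · exact ⟨a, ha, (hαβ a ha).1, (hαβ a ha).2, h0, h⟩
    rcases mul_eq_zero.1 hγ3 with h | h
    · rcases mul_eq_zero.1 h with h | h
      · refine one (b := j) (c := k) (.inl rfl) h hγ ?_ fun a b c => ⟨a, b, c⟩
        rw [h] at h62; linarith
      · refine one (b := k) (c := i) (.inr (.inl rfl)) h (by linarith) ?_
          fun a b c => ⟨c, a, b⟩
        rw [h] at h62; linarith
    · refine one (b := i) (c := j) (.inr (.inr rfl)) h (by linarith) ?_ fun a b c => ⟨b, c, a⟩
      rw [h] at h62; linarith
  -- The values of D at the other two pairs are opposite and non-zero, so the cyclic sum is -D²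
  -- times the value of the second function at the pair i, which must vanish.
  · have hD {w : ℝ} (hw : w ≠ 0) : (α j + Complex.I * w * β j : ℂ) ^ 2 ≠ 0 :=
      pow_ne_zero 2 fun h => hj (add_I_mul_eq_zero hw h)
    have h3' : (α j + Complex.I * w₃ * β j : ℂ) ^ 2 * (γ i * f₃) = 0 := by
      rw [← neg_zero, ← h₃]; push_cast; ring
    have h4' : (α j + Complex.I * w₄ * β j : ℂ) ^ 2 * (γ i * F₀ + Complex.I * w₄' * ζ i) = 0 := by
      rw [← neg_zero, ← h₄]; push_cast; ring
    have h3'' := (mul_eq_zero.1 h3').resolve_left (hD hw₃)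
    have h4'' := (mul_eq_zero.1 h4').resolve_left (hD hw₄)
    rw [← Complex.ofReal_mul] at h4''
    obtain ⟨hγF, hζi⟩ := add_I_mul_eq_zero hw₄' h4''
    refine ⟨i, .inl rfl, hαi, hβi, ?_, hζi⟩
    rcases hF with hF | ⟨hF, -⟩
    · exact (mul_eq_zero.1 hγF).resolve_right hF
    · exact_mod_cast (mul_eq_zero.1 h3'').resolve_right hF

/-- The indices are the pairs ab, bc, ca, and α, β, γ, ζ the four kinds of difference. `h₁` or `h₂`
gives a pair with α = β = 0; the other relations then find a pair, possibly a different one, where γ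
and ζ vanish as well. The hypothesis on the product of the ζ is F(3) = 0. -/
theorem difference_values {α β γ ζ : Fin 3 → ℝ} {F₀ : ℝ} {f₁ f₃ f₅ : ℂ}
    {w₁ w₂ w₃ w₄ w₄' w₆ : ℝ} (hw₁ : w₁ ≠ 0) (hw₂ : w₂ ≠ 0) (hw₃ : w₃ ≠ 0) (hw₄ : w₄ ≠ 0)
    (hw₄' : w₄' ≠ 0) (hw₆ : w₆ ≠ 0)
    (hα : α 0 + α 1 + α 2 = 0) (hβ : β 0 + β 1 + β 2 = 0) (hγ : γ 0 + γ 1 + γ 2 = 0)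
    (hζ : ζ 0 * ζ 1 * ζ 2 = 0)
    (h₁ : cyclicSum (α 0 + Complex.I * w₁ * β 0) (α 1 + Complex.I * w₁ * β 1)
      (α 2 + Complex.I * w₁ * β 2) ((α 0 + Complex.I * w₁ * β 0) * f₁)
      ((α 1 + Complex.I * w₁ * β 1) * f₁) ((α 2 + Complex.I * w₁ * β 2) * f₁) = 0)
    (h₂ : cyclicSum (α 0 + Complex.I * w₂ * β 0) (α 1 + Complex.I * w₂ * β 1)
      (α 2 + Complex.I * w₂ * β 2) ((α 0 + Complex.I * w₂ * β 0) * F₀)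
      ((α 1 + Complex.I * w₂ * β 1) * F₀) ((α 2 + Complex.I * w₂ * β 2) * F₀) = 0)
    (h₃ : cyclicSum (α 0 + Complex.I * w₃ * β 0) (α 1 + Complex.I * w₃ * β 1)
      (α 2 + Complex.I * w₃ * β 2) (γ 0 * f₃) (γ 1 * f₃) (γ 2 * f₃) = 0)
    (h₄ : cyclicSum (α 0 + Complex.I * w₄ * β 0) (α 1 + Complex.I * w₄ * β 1)
      (α 2 + Complex.I * w₄ * β 2) (γ 0 * F₀ + Complex.I * w₄' * ζ 0)
      (γ 1 * F₀ + Complex.I * w₄' * ζ 1) (γ 2 * F₀ + Complex.I * w₄' * ζ 2) = 0)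
    (h₅ : cyclicSum (γ 0) (γ 1) (γ 2) (γ 0 * f₅) (γ 1 * f₅) (γ 2 * f₅) = 0)
    (h₆ : cyclicSum (γ 0) (γ 1) (γ 2) (γ 0 * F₀ + Complex.I * w₆ * ζ 0)
      (γ 1 * F₀ + Complex.I * w₆ * ζ 1) (γ 2 * F₀ + Complex.I * w₆ * ζ 2) = 0)
    (hF : F₀ ≠ 0 ∨ f₁ ≠ 0 ∧ f₃ ≠ 0 ∧ f₅ ≠ 0) :
    ∃ l, α l = 0 ∧ β l = 0 ∧ γ l = 0 ∧ ζ l = 0 := by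
  have hF' : F₀ ≠ 0 ∨ f₃ ≠ 0 ∧ f₅ ≠ 0 := hF.imp_right And.right
  have triple {w : ℝ} {f : ℂ} (hw : w ≠ 0) (hf : f ≠ 0)
      (h : cyclicSum (α 0 + Complex.I * w * β 0) (α 1 + Complex.I * w * β 1)
        (α 2 + Complex.I * w * β 2) ((α 0 + Complex.I * w * β 0) * f)
        ((α 1 + Complex.I * w * β 1) * f) ((α 2 + Complex.I * w * β 2) * f) = 0) :
      ∃ i, α i = 0 ∧ β i = 0 := by
    -- When the second function is f times the first, the three terms of the cyclic sum coincide.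
    have : (3 * f) * ((α 0 + Complex.I * w * β 0) * (α 1 + Complex.I * w * β 1) *
        (α 2 + Complex.I * w * β 2)) = 0 := by
      rw [← h, cyclicSum]; ring
    rcases mul_eq_zero.1 ((mul_eq_zero.1 this).resolve_left (by simpa using hf)) with h | h
    · rcases mul_eq_zero.1 h with h | h
      exacts [⟨0, add_I_mul_eq_zero hw h⟩, ⟨1, add_I_mul_eq_zero hw h⟩]
    · exact ⟨2, add_I_mul_eq_zero hw h⟩
  have hex : ∃ i, α i = 0 ∧ β i = 0 := by
    rcases hF with hF | ⟨hF, -⟩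
    · exact triple hw₂ (by exact_mod_cast hF) h₂
    · exact triple hw₁ hF h₁
  obtain ⟨i, hαi, hβi⟩ := hex
  fin_cases i
  · obtain ⟨l, -, h⟩ := difference_values_aux hw₃ hw₄ hw₄' hw₆ hα hβ hγ hζ h₃ h₄ h₅ h₆ hF'
      hαi hβi
    exact ⟨l, h⟩
  · obtain ⟨l, -, h⟩ := difference_values_aux (i := 1) (j := 2) (k := 0) hw₃ hw₄ hw₄' hw₆
      (by linarith) (by linarith) (by linarith) (by linarith)
      ((cyclicSum_rotate ..).trans h₃) ((cyclicSum_rotate ..).trans h₄)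
      ((cyclicSum_rotate ..).trans h₅) ((cyclicSum_rotate ..).trans h₆) hF' hαi hβi
    exact ⟨l, h⟩
  · obtain ⟨l, -, h⟩ := difference_values_aux (i := 2) (j := 0) (k := 1) hw₃ hw₄ hw₄' hw₆
      (by linarith) (by linarith) (by linarith) (by linarith)
      ((cyclicSum_rotate ..).symm.trans h₃) ((cyclicSum_rotate ..).symm.trans h₄)
      ((cyclicSum_rotate ..).symm.trans h₅) ((cyclicSum_rotate ..).symm.trans h₆) hF' hαi hβi
    exact ⟨l, h⟩

theorem PC_ne_zero {s w : ℝ} {x : Config} (hw : w ≠ 0) (h : ¬ (P1 s x = 0 ∧ P2 s x = 0)) :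
    PC s x w ≠ 0 := by
  intro h0
  rw [PC, ← Complex.ofReal_pow] at h0
  obtain ⟨h1, h2⟩ := add_I_mul_eq_zero hw h0
  exact h ⟨by simpa using h1, h2⟩

theorem FC_ne_zero {w : ℝ} {x : Config} (hw : w ≠ 0) (h : ¬ (F1 x = 0 ∧ F2 x = 0)) :
    FC x w ≠ 0 :=
  fun h0 => h (add_I_mul_eq_zero hw h0)

/-! ### The case distinction on F(3) and P(3) -/

theorem equivalent_of_V_eq_zero {s : ℝ} (hs : s ≠ 0) {u : Fin 15 → ℝ} (hu : ∀ k, u k ≠ 0)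
    {x : Config} (hx : IsCollisionEvent x) (hV : ∀ i, V s u i x = 0) :
    Equivalent x (parity x) := by
  have k1 : P1 s x * F3 x = 0 := hV 0
  have k2 : P2 s x * F3 x = 0 := hV 1
  have k3 : P3 s x * F0 x = 0 := hV 2
  have k4 : P3 s x * F1 x = 0 := hV 3
  have k5 : P3 s x * F2 x = 0 := hV 4
  have k6 : V6 s x = 0 := hV 5
  have k7 : V7 s x = 0 := hV 6
  have c1 : v1 s u x = 0 := Complex.ext (hV 7) (hV 8)
  have c2 : v2 s u x = 0 := Complex.ext (hV 9) (hV 10)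
  have c3 : v3 s u x = 0 := Complex.ext (hV 11) (hV 12)
  have c4 : v4 s u x = 0 := Complex.ext (hV 13) (hV 14)
  have c5 : v5 s u x = 0 := Complex.ext (hV 15) (hV 16)
  have c6 : v6 s u x = 0 := Complex.ext (hV 17) (hV 18)
  by_cases he : eps s x (va x) (vb x) = 0 ∧ eps s x (vb x) (vc x) = 0 ∧
      eps s x (vc x) (va x) = 0
  · exact equivalent_of_eps_eq_zero hs hx he.1 he.2.1 he.2.2
  have hP (h1 : P1 s x = 0) (h2 : P2 s x = 0) (h3 : P3 s x = 0) : False :=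
    he (eq_zero_of_symmetric_values h1 h2 h3)
  obtain ⟨n, hn⟩ : ∃ n, n = vp x - vq x := ⟨_, rfl⟩
  have hF1 : F1 x = g x (va x) n + g x (vb x) n + g x (vc x) n := by
    rw [F1, g_add_left, g_add_left, hn]
  have hF2 : F2 x = g x (va x) n * g x (vb x) n * g x (vc x) n := by rw [F2, hn]
  have hF3 : F3 x = (g x (va x) n - g x (vb x) n) * (g x (vb x) n - g x (vc x) n) *
      (g x (vc x) n - g x (va x) n) := by
    rw [F3, hn, g_sub_left, g_sub_left, g_sub_left]
  have orthogonal (h0 : F0 x = 0) (h1 : F1 x = 0) (h2 : F2 x = 0) (h3 : F3 x = 0) :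
      Equivalent x (parity x) := by
    rw [hF1] at h1
    rw [hF2] at h2
    rw [hF3] at h3
    obtain ⟨ha, hb, hc⟩ := eq_zero_of_symmetric_values h1 h2 h3
    refine equivalent_of_orthogonal hx h0 fun i => ?_
    rw [← hn]
    fin_cases i
    exacts [ha, hb, hc]
  have hba := eps_swap s x (vb x) (va x)
  have hcb := eps_swap s x (vc x) (vb x)
  have hac := eps_swap s x (va x) (vc x)
  by_cases h3 : F3 x = 0
  · by_cases hP3 : P3 s x = 0
    · have hP12 : ¬ (P1 s x = 0 ∧ P2 s x = 0) := fun h => hP h.1 h.2 hP3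
      by_cases hF : F0 x = 0 ∧ F1 x = 0 ∧ F2 x = 0
      · exact orthogonal hF.1 hF.2.1 hF.2.2 h3
      have hF' : F0 x ≠ 0 ∨ FC x (u 2) ≠ 0 ∧ FC x (u 6) ≠ 0 ∧ FC x (u 12) ≠ 0 := by
        by_cases h0 : F0 x = 0
        · have : ¬ (F1 x = 0 ∧ F2 x = 0) := fun h => hF ⟨h0, h⟩
          exact .inr ⟨FC_ne_zero (hu 2) this, FC_ne_zero (hu 6) this, FC_ne_zero (hu 12) this⟩
        · exact .inl h0
      have U0 {w : ℝ} {z : ℂ} (hw : w ≠ 0) (h : PC s x w * z = 0) : z = 0 :=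
        (mul_eq_zero.1 h).resolve_left (PC_ne_zero hw hP12)
      obtain ⟨l, hl1, hl2, hl3, hl4⟩ := difference_values
        (α := ![df1 x (va x) (vb x), df1 x (vb x) (vc x), df1 x (vc x) (va x)])
        (β := ![df2 x (va x) (vb x), df2 x (vb x) (vc x), df2 x (vc x) (va x)])
        (γ := ![df3 (va x) (vb x), df3 (vb x) (vc x), df3 (vc x) (va x)])
        (ζ := ![df4 x (va x) (vb x), df4 x (vb x) (vc x), df4 x (vc x) (va x)])
        (hu 0) (hu 3) (hu 5) (hu 8) (hu 9) (hu 13)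
        (by simp [df1]) (by simp [df2]) (by simp [df3])
        (by rw [hF3, hn] at h3; exact h3)
        (U0 (hu 1) c1) (U0 (hu 4) c2) (U0 (hu 7) c3) (U0 (hu 10) c4) (U0 (hu 11) c5)
        (U0 (hu 14) c6) hF'
      -- If the two momenta of the pair coincided, their bracket would vanish and the other two
      -- would cancel, making P(1) = P(2) = 0.
      have absurd_of_eq {e₁ e₂ e₃ : ℝ} (h1 : e₁ = 0) (h2 : e₂ = -e₃)
          (hs : P1 s x = e₁ + e₂ + e₃) (hp : P2 s x = e₁ * e₂ * e₃) : False :=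
        hP12 ⟨by rw [hs, h1, h2]; ring, by rw [hp, h1]; ring⟩
      fin_cases l
      · refine equivalent_of_differences hx (i := 0) (j := 1) (k := 2) (by decide) (by decide)
          (by decide) rfl (fun h => ?_) hl1 hl2 hl3 hl4
        replace h : va x = vb x := h
        exact absurd_of_eq (by rw [h, eps_self]) (by rw [← h, hac]) rfl rfl
      · refine equivalent_of_differences hx (i := 1) (j := 2) (k := 0) (by decide) (by decide)
          (by decide) (by simp only [va, vb, vc]; abel) (fun h => ?_) hl1 hl2 hl3 hl4
        replace h : vb x = vc x := h
        exact absurd_of_eq (e₁ := eps s x (vb x) (vc x)) (e₂ := eps s x (vc x) (va x))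
          (e₃ := eps s x (va x) (vb x)) (by rw [h, eps_self]) (by rw [← h, hba])
          (by rw [P1]; ring) (by rw [P2]; ring)
      · refine equivalent_of_differences hx (i := 2) (j := 0) (k := 1) (by decide) (by decide)
          (by decide) (by simp only [va, vb, vc]; abel) (fun h => ?_) hl1 hl2 hl3 hl4
        replace h : vc x = va x := h
        exact absurd_of_eq (e₁ := eps s x (vc x) (va x)) (e₂ := eps s x (va x) (vb x))
          (e₃ := eps s x (vb x) (vc x)) (by rw [h, eps_self]) (by rw [← h, hcb])
          (by rw [P1]; ring) (by rw [P2]; ring)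
    · exact orthogonal ((mul_eq_zero.1 k3).resolve_left hP3)
        ((mul_eq_zero.1 k4).resolve_left hP3) ((mul_eq_zero.1 k5).resolve_left hP3) h3
  · have hP1 := (mul_eq_zero.1 k1).resolve_right h3
    have hP2 := (mul_eq_zero.1 k2).resolve_right h3
    have hP3 : P3 s x ≠ 0 := hP hP1 hP2
    have h0 := (mul_eq_zero.1 k3).resolve_left hP3
    have h1 := (mul_eq_zero.1 k4).resolve_left hP3
    have h2 := (mul_eq_zero.1 k5).resolve_left hP3
    have h23 : 2 * (P3 s x * F3 x) ≠ 0 := mul_ne_zero two_ne_zero (mul_ne_zero hP3 h3)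
    have h6 := (mul_eq_zero.1 ((V6_eq s x hn).symm.trans k6)).resolve_left h23
    have h7 := (mul_eq_zero.1 ((V7_eq s x hn).symm.trans k7)).resolve_left h23
    rw [hF1] at h1
    rw [hF2] at h2
    rw [hF3] at h3
    rw [P1] at hP1
    rw [P2] at hP2
    -- The vanishing factor of F(2) singles out the momentum fixed by the mirror; the other two are
    -- exchanged. The three branches are cyclic rotations of one another.
    rcases mul_eq_zero.1 h2 with h | hc
    · rcases mul_eq_zero.1 h with ha | hb
      · obtain ⟨e1, e2, e3⟩ := exchange_values (z₁ := g x (vb x) n) (z₂ := g x (vc x) n)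
          (e₁ := eps s x (vb x) (vc x)) (e₂ := eps s x (vc x) (va x))
          (e₃ := eps s x (va x) (vb x)) (m₁ := mink (vb x) (vb x))
          (m₂ := mink (vc x) (vc x)) (m₃ := mink (va x) (va x))
          (by linarith) ha (by convert h3 using 1; ring) (by linarith) (by linarith)
          (by linarith) (by linarith)
        refine equivalent_of_exchange hx (i := 1) (j := 2) (k := 0) (by decide) (by decide)
          (by decide) h0 ?_ ?_ e1 ?_ ?_ e3
        · rw [← hn]; change g x (vb x) n + g x (vc x) n = 0; linarith
        · rw [← hn]; exact ha
        · change eps s x (vb x) (va x) = eps s x (vc x) (va x); linarith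
        · change eps s x (vb x) (va x) ≠ 0
          intro h
          exact he ⟨by linarith, by linarith, by linarith⟩
      · obtain ⟨e1, e2, e3⟩ := exchange_values (z₁ := g x (vc x) n) (z₂ := g x (va x) n)
          (e₁ := eps s x (vc x) (va x)) (e₂ := eps s x (va x) (vb x))
          (e₃ := eps s x (vb x) (vc x)) (m₁ := mink (vc x) (vc x))
          (m₂ := mink (va x) (va x)) (m₃ := mink (vb x) (vb x))
          (by linarith) hb (by convert h3 using 1; ring) (by linarith) (by linarith)
          (by linarith) (by linarith)
        refine equivalent_of_exchange hx (i := 2) (j := 0) (k := 1) (by decide) (by decide)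
          (by decide) h0 ?_ ?_ e1 ?_ ?_ e3
        · rw [← hn]; change g x (vc x) n + g x (va x) n = 0; linarith
        · rw [← hn]; exact hb
        · change eps s x (vc x) (vb x) = eps s x (va x) (vb x); linarith
        · change eps s x (vc x) (vb x) ≠ 0
          intro h
          exact he ⟨by linarith, by linarith, by linarith⟩
    · obtain ⟨e1, e2, e3⟩ := exchange_values h1 hc h3 hP1 hP2 h6 h7
      refine equivalent_of_exchange hx (i := 0) (j := 1) (k := 2) (by decide) (by decide)
        (by decide) h0 ?_ ?_ e1 ?_ ?_ e3
      · rw [← hn]; change g x (va x) n + g x (vb x) n = 0; linarith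
      · rw [← hn]; exact hc
      · change eps s x (va x) (vc x) = eps s x (vb x) (vc x); linarith
      · change eps s x (va x) (vc x) ≠ 0
        intro h
        exact he ⟨e1, by linarith, by linarith⟩

end Chirality

theorem mainTheorem5 (s : ℝ) (hs : s = 1 ∨ s = -1) (u : Fin 15 → ℝ) (hu : ∀ k, u k ≠ 0) :
    (∀ i : Fin 19,
      (∃ Q : MvPolynomial ((Fin 2 ⊕ Fin 3) × Fin 4) ℝ, ∀ x : Chirality.Config,
        Chirality.V s u i x = MvPolynomial.eval (fun k => x k.1 k.2) Q) ∧
      Continuous (Chirality.V s u i) ∧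
      (∀ L ∈ Chirality.SOPlus, ∀ x : Chirality.Config,
        Chirality.V s u i (Chirality.lorentzAct L x) = Chirality.V s u i x) ∧
      (∀ (τ : Equiv.Perm (Fin 2)) (σ : Equiv.Perm (Fin 3)) (x : Chirality.Config),
        Chirality.V s u i (Chirality.permAct τ σ x) = Chirality.V s u i x) ∧
      (∀ x : Chirality.Config,
        Chirality.V s u i (Chirality.parity x) = -Chirality.V s u i x)) ∧
    (∀ x : Chirality.Config, Chirality.IsCollisionEvent x → Chirality.IsChiral x →
      ∃ i : Fin 19, Chirality.V s u i x ≠ 0) := by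
  refine ⟨fun i => ⟨Chirality.isPoly_V s u i, (Chirality.isPoly_V s u i).continuous,
    fun L hL x => ?_, fun τ σ x => Chirality.V_permAct s τ σ x u i, fun x => ?_⟩,
    fun x hx hc => ?_⟩
  · rw [Chirality.V_lorentzAct ((Chirality.isometry_iff L).2 hL.1) (by rw [hL.2.1]; norm_num),
      hL.2.1, one_mul]
  · rw [Chirality.parity_eq_lorentzAct, Chirality.V_lorentzAct Chirality.mink_metric_mulVec
      (by rw [Chirality.det_metric]; norm_num), Chirality.det_metric, neg_one_mul]
  · by_contra! h
    refine hc (Chirality.equivalent_of_V_eq_zero (s := s) ?_ hu hx h)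
    rcases hs with rfl | rfl <;> norm_num
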